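/- **Setting.** Let $\Omega\subset\mathbb R^n$ be a domain (open, connected) with smooth boundary, i.e. near each boundary point $\Omega$ is the positivity set of a smooth function with non-zero differential at that point. Suppose that for some $R_0\ge 1$, with $B(0,R_0)$ the open ball and $S(0,R_0)$ the sphere, $$\Omega\setminus B(0,R_0)=\{\lambda p\;:\;p\in\Omega\cap S(0,R_0),\ \lambda\ge 1\}.$$ Let $x:\overline\Omega\to\mathbb R$ be a defining function for $\partial\Omega$, smooth up to the boundary ($x>0$ on $\Omega$, and $x=0$, $dx\ne0$ on $\partial\Omega$), such that $x(\lambda p)=\lambda x(p)$ whenever $\lambda\ge1$ and $p,\lambda p\in\Omega\setminus B(0,R_0)$. Let $r$ be a function smooth on $\overline\Omega$, bounded below on $\Omega$ by a positive constant, with $r(p)=|p|$ on $\Omega\setminus B(0,R_0)$. Let $g$ be a locally Lipschitz ($W^{1,\infty}_{\rm loc}$) Riemannian metric on $\overline\Omega$ such that, as $|p|\to\infty$ in $\Omega$, $g_{ij}(p)\to\delta_{ij}$ (with no rate imposed) and $\partial_k g_{ij}=o(1/|p|)$ (for almost every $p$). Norms of tensors, the Levi-Civita derivative $\nabla$, the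 measure $d\mu_g$ and the induced measure $d\sigma_g$ on hypersurfaces are those of $g$. **Proposition.** Let $s,\sigma,\mu\in\mathbb R$ with $s\neq0$ and $\sigma+\mu+n/2\ne0$. There exist constants $x_0>0$, $C>0$ and $R>R_0$, where $R$ is such that $\{p\in\Omega: r(p)=R\}=\Omega\cap S(0,R)$, such that for all $C^2$ tensor fields $u$ (of any rank and type) compactly supported in $\Omega$, $$\int_\Omega x^{2\sigma}r^{2\mu}e^{-sr/x}|u|^2\,d\mu_g\le C\left(\int_{\{x\ge x_0,\,r=R\}}|u|^2\,d\sigma_g+\int_{\{x\ge x_0,\,r\le R\}}|u|^2\,d\mu_g+\int_\Omega x^{2\sigma+4}r^{2\mu-2}e^{-sr/x}|\nabla u|^2\,d\mu_g\right).$$ -/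

import Mathlib

open Filter Topology MeasureTheory Set
open scoped ContDiff

noncomputable section

/-- The model space `ℝⁿ` with its Euclidean norm. -/
abbrev Euc (n : ℕ) : Type := EuclideanSpace ℝ (Fin n)

namespace Euc

variable {n : ℕ}

/-! ### The domain and the functions `x` and `r` -/

/-- `Ω` has smooth boundary: near each boundary point, `Ω` is the positivity set of a smooth
function whose differential does not vanish at that point. -/
def HasSmoothBoundary (Ω : Set (Euc n)) : Prop :=
  ∀ p ∈ frontier Ω, ∃ U : Set (Euc n), IsOpen U ∧ p ∈ U ∧ ∃ f : Euc n → ℝ,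
    ContDiffOn ℝ ∞ f U ∧ f p = 0 ∧ fderiv ℝ f p ≠ 0 ∧ Ω ∩ U = {q ∈ U | 0 < f q}

/-- A domain with smooth boundary which is invariant under scaling at distances at least `R₀`
from the origin. -/
structure IsScaleInvariantDomain (Ω : Set (Euc n)) (R₀ : ℝ) : Prop where
  isOpen : IsOpen Ω
  isConnected : IsConnected Ω
  smoothBoundary : HasSmoothBoundary Ω
  one_le : 1 ≤ R₀
  scaling : Ω \ Metric.ball 0 R₀ =
    {q | ∃ p ∈ Ω ∩ Metric.sphere 0 R₀, ∃ l : ℝ, 1 ≤ l ∧ q = l • p}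

/-- `x` is a defining function for the boundary of `Ω`, smooth up to the boundary, which is
homogeneous of degree one at distances at least `R₀` from the origin. -/
structure IsScalingDefiningFunction (Ω : Set (Euc n)) (R₀ : ℝ) (x : Euc n → ℝ) : Prop where
  smooth : ContDiffOn ℝ ∞ x (closure Ω)
  pos : ∀ p ∈ Ω, 0 < x p
  zero : ∀ p ∈ frontier Ω, x p = 0
  deriv_ne_zero : ∀ p ∈ frontier Ω, fderivWithin ℝ x (closure Ω) p ≠ 0
  scaling : ∀ l : ℝ, 1 ≤ l → ∀ p ∈ Ω \ Metric.ball 0 R₀, l • p ∈ Ω \ Metric.ball 0 R₀ →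
    x (l • p) = l * x p

/-- `r` is smooth up to the boundary, bounded away from zero, and coincides with the coordinate
radius at distances at least `R₀` from the origin. -/
structure IsRadiusFunction (Ω : Set (Euc n)) (R₀ : ℝ) (r : Euc n → ℝ) : Prop where
  smooth : ContDiffOn ℝ ∞ r (closure Ω)
  bddBelow : ∃ c : ℝ, 0 < c ∧ ∀ p ∈ Ω, c ≤ r p
  eq_norm : ∀ p ∈ Ω \ Metric.ball 0 R₀, r p = ‖p‖

/-! ### Riemannian metrics and tensor fields in the coordinates of `ℝⁿ` -/

/-- The partial derivative `∂ₖ f` at `p`. -/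
def pderiv (k : Fin n) (f : Euc n → ℝ) (p : Euc n) : ℝ :=
  fderiv ℝ f p (EuclideanSpace.single k 1)

/-- `g` is (the matrix of components `g i j` of) a Riemannian metric of class `W^{1,∞}_loc`,
i.e. locally Lipschitz, up to the boundary of `Ω`, which approaches the Euclidean metric at
infinity without any rate, with first derivatives that are `o(1/r)`. The first derivatives
exist almost everywhere by Rademacher's theorem. -/
structure IsAsymptoticallyEuclideanMetric (Ω : Set (Euc n))
    (g : Euc n → Matrix (Fin n) (Fin n) ℝ) : Prop where
  posDef : ∀ p ∈ closure Ω, (g p).PosDef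
  locLipschitz : ∀ i j, LocallyLipschitzOn (closure Ω) (fun p => g p i j)
  tendsto_euclidean : ∀ i j, Tendsto (fun p => g p i j)
    (Bornology.cobounded (Euc n) ⊓ 𝓟 Ω) (𝓝 ((1 : Matrix (Fin n) (Fin n) ℝ) i j))
  deriv_isLittleO : ∀ i j k, (fun p => pderiv k (fun q => g q i j) p)
    =o[Bornology.cobounded (Euc n) ⊓ 𝓟 Ω ⊓ ae volume] (fun p => ‖p‖⁻¹)

/-- The type of an index slot of a tensor. -/
inductive Variance where
  | covariant
  | contravariant

/-- A tensor of rank `m` on `ℝⁿ`, given by its components. -/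
abbrev Tensor (n m : ℕ) : Type := (Fin m → Fin n) → ℝ

/-- The Christoffel symbol `Γᵏᵢⱼ` of `g`. -/
def christoffel (g : Euc n → Matrix (Fin n) (Fin n) ℝ) (p : Euc n) (k i j : Fin n) : ℝ :=
  (1 / 2) * ∑ l, (g p)⁻¹ k l *
    (pderiv i (fun q => g q j l) p + pderiv j (fun q => g q i l) p
      - pderiv l (fun q => g q i j) p)

/-- The component `(∇ₖ u)_I` of the Levi-Civita covariant derivative of a tensor field `u` whose
index slots have the types `ε`. -/
def covDeriv {m : ℕ} (ε : Fin m → Variance) (g : Euc n → Matrix (Fin n) (Fin n) ℝ)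
    (u : Euc n → Tensor n m) (p : Euc n) (k : Fin n) : Tensor n m := fun I =>
  pderiv k (fun q => u q I) p + ∑ a, ∑ l,
    (match ε a with
      | .contravariant => christoffel g p (I a) k l
      | .covariant => - christoffel g p l k (I a)) * u p (Function.update I a l)

/-- The bilinear form used by the metric `G` to contract two index slots of type `v`. -/
def slotMetric (v : Variance) (G : Matrix (Fin n) (Fin n) ℝ) : Matrix (Fin n) (Fin n) ℝ :=
  match v with
  | .covariant => G⁻¹
  | .contravariant => G

/-- The inner product on tensors of type `ε` induced by the inner product `G` on `ℝⁿ`. -/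
def tensorInner {m : ℕ} (ε : Fin m → Variance) (G : Matrix (Fin n) (Fin n) ℝ)
    (S T : Tensor n m) : ℝ :=
  ∑ I, ∑ J, (∏ a, slotMetric (ε a) G (I a) (J a)) * S I * T J

/-- `|u|²` with respect to `g` at the point `p`. -/
def normSq {m : ℕ} (ε : Fin m → Variance) (g : Euc n → Matrix (Fin n) (Fin n) ℝ)
    (u : Euc n → Tensor n m) (p : Euc n) : ℝ :=
  tensorInner ε (g p) (u p) (u p)

/-- `|∇u|²` with respect to `g` at the point `p`. -/
def gradNormSq {m : ℕ} (ε : Fin m → Variance) (g : Euc n → Matrix (Fin n) (Fin n) ℝ)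
    (u : Euc n → Tensor n m) (p : Euc n) : ℝ :=
  ∑ k, ∑ l, (g p)⁻¹ k l * tensorInner ε (g p) (covDeriv ε g u p k) (covDeriv ε g u p l)

/-! ### Riemannian integrals -/

/-- The density of the Riemannian measure of `g` with respect to Lebesgue measure. -/
def volDensity (g : Euc n → Matrix (Fin n) (Fin n) ℝ) (p : Euc n) : ℝ :=
  Real.sqrt (g p).det

/-- The integral over `A` of `f` against the Riemannian measure of `g`. -/
def volIntegral (g : Euc n → Matrix (Fin n) (Fin n) ℝ) (A : Set (Euc n)) (f : Euc n → ℝ) : ℝ :=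
  ∫ p in A, f p * volDensity g p

/-- The Euclidean surface measure of the sphere of radius `R` about the origin of `ℝⁿ`. -/
def sphereMeasure (n : ℕ) (R : ℝ) : Measure (Euc n) :=
  ENNReal.ofReal (R ^ (n - 1)) •
    (volume : Measure (Euc n)).toSphere.map (fun w : Metric.sphere (0 : Euc n) 1 => R • (w : Euc n))

/-- The density, with respect to the Euclidean surface measure, of the surface measure induced by
`g` on the spheres about the origin: `√(det g · gⁱʲ νᵢ νⱼ)`, with `ν` the Euclidean unit
conormal. -/
def sphereDensity (g : Euc n → Matrix (Fin n) (Fin n) ℝ) (p : Euc n) : ℝ :=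
  Real.sqrt ((g p).det * ∑ i, ∑ j, (g p)⁻¹ i j * (p i / ‖p‖) * (p j / ‖p‖))

/-- The integral of `f` over the part in `A` of the sphere of radius `R` about the origin, against
the surface measure induced by `g`. -/
def sphereIntegral (g : Euc n → Matrix (Fin n) (Fin n) ℝ) (R : ℝ) (A : Set (Euc n))
    (f : Euc n → ℝ) : ℝ :=
  ∫ p in A, f p * sphereDensity g p ∂(sphereMeasure n R)

end Euc

end

-- The entrywise sup norm on matrices: limits, derivatives and Lipschitz bounds of `g` can be read
-- off its entries.
attribute [local instance] Matrix.normedAddCommGroup Matrix.normedSpace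

namespace Euc

variable {n m : ℕ}

/-! ### Linear algebra of tensor inner products -/

/-! Write `w = x^{2σ} r^{2μ} e^{-sr/x}`, `t = x/r`, `β = σ + μ + n/2` and `D = √(det g)`. The
estimate comes from a vector field multiplier `φ` of size `O(w x²/r)`: the divergence of `|u|² D φ`
integrates to zero because `u` has compact support in `Ω`. By metric compatibility (`pderiv_normSq`)
this divergence is `|u|² div(D φ) + 2 D φᵏ ⟨∇ₖu, u⟩`. Once `div(D φ) ≥ c w D`, weighted
Cauchy–Schwarz absorbs the cross term into half of the main term and leaves `|φ|²/w = O(w x⁴/r²)` in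
front of `|∇u|²`, which is exactly the weight on the right-hand side (`volIntegral_weight_le`).

The multiplier has two pieces, both built from Euclidean derivatives. The gradient piece `sign(s) w
(x²/r) ∇x` has divergence `|s| |∇x|² w` plus errors `O(t) w`, since each derivative of the
exponential costs `r/x²`. By homogeneity `|∇x|` is bounded below where `t` is small, uniformly up to
infinity, but it may vanish elsewhere. The radial piece `A sign(β) χ w (x²/r²) p` compensates:
`e^{-sr/x}` has degree zero, so by Euler's relation its divergence is `2 A |β| t² w` where the
cutoff `χ` is one. For large `A` this beats the errors as soon as `t` is not small.

The derivatives of `g` affect `div(D φ)` only through `∂D = o(1/r) D`, hence by a small multiple of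
`t² w`, which the radial piece absorbs at large radii. No rate of convergence of `g` is needed: its
convergence serves only to keep its values in a compact set of positive definite matrices. As `g` is
merely Lipschitz, the identities hold almost everywhere, by Rademacher's theorem.

In `r ≤ R` the terms from `χ` and `∂D` have no sign, but they are `O(t²) w`, negligible for `x <
x₀`; on `x ≥ x₀`, `r ≤ R` the weight is bounded, and the error is paid for by the second integral on
the right. `exists_carlemanField` contains these pointwise bounds. The sphere integral enters only
through its sign. -/

theorem slotMetric_posDef {G : Matrix (Fin n) (Fin n) ℝ} (hG : G.PosDef) (v : Variance) :
    (slotMetric v G).PosDef := by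
  cases v
  · exact hG.inv
  · exact hG

open scoped MatrixOrder in
theorem exists_sum_mul_eq_of_posSemidef {G : Matrix (Fin n) (Fin n) ℝ} (hG : G.PosSemidef) :
    ∃ B : Matrix (Fin n) (Fin n) ℝ, ∀ i j, G i j = ∑ k, B k i * B k j := by
  obtain ⟨B, rfl⟩ := CStarAlgebra.nonneg_iff_eq_star_mul_self.mp hG.nonneg
  exact ⟨B, fun i j => by simp [Matrix.mul_apply, Matrix.star_apply]⟩

/-- The tensor inner product of a positive definite matrix is a sum of products of linear forms. -/
theorem exists_tensorInner_eq_sum {G : Matrix (Fin n) (Fin n) ℝ} (hG : G.PosDef)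
    (ε : Fin m → Variance) :
    ∃ B : (Fin m → Fin n) → Tensor n m, ∀ S T : Tensor n m,
      tensorInner ε G S T = ∑ K, (∑ I, B K I * S I) * (∑ J, B K J * T J) := by
  choose B hB using fun a => exists_sum_mul_eq_of_posSemidef
    (slotMetric_posDef hG (ε a)).posSemidef
  -- The tensor product, over the slots, of the factors `B a` with `slotMetric = (B a)ᵀ (B a)`.
  refine ⟨fun K I => ∏ a, B a (K a) (I a), fun S T => ?_⟩
  have key : ∀ I J : Fin m → Fin n, ∏ a, slotMetric (ε a) G (I a) (J a)
      = ∑ K : Fin m → Fin n, (∏ a, B a (K a) (I a)) * (∏ a, B a (K a) (J a)) := by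
    intro I J
    simp_rw [hB, ← Finset.prod_mul_distrib]
    rw [Finset.prod_univ_sum, Fintype.piFinset_univ]
  simp_rw [tensorInner, key, Finset.sum_mul_sum, Finset.sum_mul]
  rw [Finset.sum_comm' (t' := Finset.univ) (s' := fun _ => Finset.univ) (by simp)]
  conv_rhs => rw [Finset.sum_comm]
  rw [Finset.sum_comm]
  refine Finset.sum_congr rfl fun I _ => ?_
  conv_rhs => rw [Finset.sum_comm]
  refine Finset.sum_congr rfl fun J _ => Finset.sum_congr rfl fun K _ => ?_
  ring

theorem tensorInner_comm {G : Matrix (Fin n) (Fin n) ℝ} (hG : G.PosDef) (ε : Fin m → Variance)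
    (S T : Tensor n m) : tensorInner ε G S T = tensorInner ε G T S := by
  obtain ⟨B, hB⟩ := exists_tensorInner_eq_sum hG ε
  simp_rw [hB, mul_comm]

theorem tensorInner_self_nonneg {G : Matrix (Fin n) (Fin n) ℝ} (hG : G.PosDef)
    (ε : Fin m → Variance) (S : Tensor n m) : 0 ≤ tensorInner ε G S S := by
  obtain ⟨B, hB⟩ := exists_tensorInner_eq_sum hG ε
  rw [hB]
  exact Finset.sum_nonneg fun K _ => mul_self_nonneg _

/-- Weighted Cauchy–Schwarz inequality for the tensor inner product. -/
theorem two_mul_abs_tensorInner_le {G : Matrix (Fin n) (Fin n) ℝ} (hG : G.PosDef)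
    (ε : Fin m → Variance) (S T : Tensor n m) {κ : ℝ} (hκ : 0 < κ) (b : ℝ) :
    2 * |b * tensorInner ε G S T|
      ≤ κ * tensorInner ε G T T + b ^ 2 / κ * tensorInner ε G S S := by
  obtain ⟨B, hB⟩ := exists_tensorInner_eq_sum hG ε
  rw [hB, hB, hB, Finset.mul_sum, Finset.mul_sum, Finset.mul_sum, ← Finset.sum_add_distrib]
  refine (mul_le_mul_of_nonneg_left (Finset.abs_sum_le_sum_abs _ _) zero_le_two).trans ?_
  rw [Finset.mul_sum]
  refine Finset.sum_le_sum fun K _ => ?_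
  generalize (∑ I, B K I * S I) = s
  generalize (∑ I, B K I * T I) = t
  -- For each `K` the claim is a scalar inequality, obtained by completing the square with either
  -- sign.
  have h1 : κ * (t * t) + b ^ 2 / κ * (s * s) - 2 * (b * (s * t)) = (κ * t - b * s) ^ 2 / κ := by
    field_simp; ring
  have h2 : κ * (t * t) + b ^ 2 / κ * (s * s) + 2 * (b * (s * t)) = (κ * t + b * s) ^ 2 / κ := by
    field_simp; ring
  have h3 : 0 ≤ (κ * t - b * s) ^ 2 / κ := by positivity
  have h4 : 0 ≤ (κ * t + b * s) ^ 2 / κ := by positivity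
  have h5 : |b * (s * t)| ≤ (κ * (t * t) + b ^ 2 / κ * (s * s)) / 2 :=
    abs_le.2 ⟨by linarith, by linarith⟩
  linarith

/-- A lower bound for a bilinear form passes to its contraction with the tensor inner product. -/
theorem sum_tensorInner_self_le {G : Matrix (Fin n) (Fin n) ℝ} (hG : G.PosDef)
    (ε : Fin m → Variance) {H : Matrix (Fin n) (Fin n) ℝ} {c : ℝ}
    (hH : ∀ v : Fin n → ℝ, c * ∑ k, v k ^ 2 ≤ ∑ k, ∑ l, H k l * (v k * v l))
    (T : Fin n → Tensor n m) :
    c * ∑ k, tensorInner ε G (T k) (T k) ≤ ∑ k, ∑ l, H k l * tensorInner ε G (T k) (T l) := by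
  obtain ⟨B, hB⟩ := exists_tensorInner_eq_sum hG ε
  have h1 : ∑ k, ∑ l, H k l * tensorInner ε G (T k) (T l)
      = ∑ K, ∑ k, ∑ l, H k l * ((∑ I, B K I * T k I) * (∑ J, B K J * T l J)) := by
    simp_rw [hB, Finset.mul_sum (s := (Finset.univ : Finset (Fin m → Fin n)))
      (f := fun K => (∑ I, B K I * _) * _)]
    rw [Finset.sum_comm]
    conv_rhs => rw [Finset.sum_comm]
    rw [Finset.sum_comm]
    refine Finset.sum_congr rfl fun k _ => Finset.sum_comm
  have h2 : c * ∑ k, tensorInner ε G (T k) (T k)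
      = ∑ K, c * ∑ k, (∑ I, B K I * T k I) ^ 2 := by
    simp_rw [hB]
    rw [Finset.sum_comm, Finset.mul_sum]
    simp_rw [sq]
  rw [h1, h2]
  exact Finset.sum_le_sum fun K _ => hH fun k => ∑ I, B K I * T k I

/-! ### Calculus of partial derivatives -/

theorem pderiv_add {f h : Euc n → ℝ} {p : Euc n} (k : Fin n) (hf : DifferentiableAt ℝ f p)
    (hh : DifferentiableAt ℝ h p) :
    pderiv k (fun q => f q + h q) p = pderiv k f p + pderiv k h p := by
  simp [pderiv, fderiv_fun_add hf hh]

theorem pderiv_mul {f h : Euc n → ℝ} {p : Euc n} (k : Fin n) (hf : DifferentiableAt ℝ f p)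
    (hh : DifferentiableAt ℝ h p) :
    pderiv k (fun q => f q * h q) p = pderiv k f p * h p + f p * pderiv k h p := by
  simp [pderiv, fderiv_fun_mul hf hh]; ring

theorem pderiv_sum {ι : Type*} (s : Finset ι) {f : ι → Euc n → ℝ} {p : Euc n} (k : Fin n)
    (hf : ∀ i ∈ s, DifferentiableAt ℝ (f i) p) :
    pderiv k (fun q => ∑ i ∈ s, f i q) p = ∑ i ∈ s, pderiv k (f i) p := by
  simp [pderiv, fderiv_fun_sum hf]

theorem pderiv_prod {ι : Type*} [DecidableEq ι] (s : Finset ι) {f : ι → Euc n → ℝ} {p : Euc n}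
    (k : Fin n) (hf : ∀ i ∈ s, DifferentiableAt ℝ (f i) p) :
    pderiv k (fun q => ∏ i ∈ s, f i q) p
      = ∑ i ∈ s, (∏ j ∈ s.erase i, f j p) * pderiv k (f i) p := by
  have := (HasFDerivAt.finsetProd (fun i hi => (hf i hi).hasFDerivAt)).fderiv
  simp only [pderiv]
  rw [this]
  simp

theorem pderiv_const (k : Fin n) (c : ℝ) (p : Euc n) : pderiv k (fun _ => c) p = 0 := by
  simp [pderiv]

theorem _root_.Filter.EventuallyEq.pderiv_eq {f h : Euc n → ℝ} {p : Euc n} (hfh : f =ᶠ[𝓝 p] h)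
    (k : Fin n) : pderiv k f p = pderiv k h p := by
  simp [pderiv, hfh.fderiv_eq]

/-! ### Smoothness of matrix operations -/

theorem contDiff_matrix_entry {N : WithTop ℕ∞} (i j : Fin n) :
    ContDiff ℝ N (fun A : Matrix (Fin n) (Fin n) ℝ => A i j) :=
  (contDiff_apply_apply ℝ ℝ i j)

theorem contDiff_matrix_det {N : WithTop ℕ∞} :
    ContDiff ℝ N (fun A : Matrix (Fin n) (Fin n) ℝ => A.det) := by
  simp_rw [Matrix.det_apply']
  exact ContDiff.sum fun σ _ => contDiff_const.mul
    (contDiff_prod fun i _ => contDiff_matrix_entry _ _)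

theorem contDiff_matrix_adjugate {N : WithTop ℕ∞} (i j : Fin n) :
    ContDiff ℝ N (fun A : Matrix (Fin n) (Fin n) ℝ => A.adjugate i j) := by
  simp_rw [Matrix.adjugate_apply]
  refine contDiff_matrix_det.comp (contDiff_pi.2 fun a => contDiff_pi.2 fun b => ?_)
  by_cases h : a = j
  · subst h; simpa using contDiff_const
  · simpa [Matrix.updateRow_ne h] using contDiff_matrix_entry a b

theorem contDiffAt_matrix_inv {N : WithTop ℕ∞} {A : Matrix (Fin n) (Fin n) ℝ} (hA : A.det ≠ 0)
    (i j : Fin n) : ContDiffAt ℝ N (fun A : Matrix (Fin n) (Fin n) ℝ => A⁻¹ i j) A := by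
  simp_rw [Matrix.inv_def, Ring.inverse_eq_inv', Matrix.smul_apply, smul_eq_mul]
  exact (contDiff_matrix_det.contDiffAt.inv hA).mul (contDiff_matrix_adjugate i j).contDiffAt

theorem contDiffAt_slotMetric {N : WithTop ℕ∞} {A : Matrix (Fin n) (Fin n) ℝ} (hA : A.det ≠ 0)
    (v : Variance) (i j : Fin n) :
    ContDiffAt ℝ N (fun A : Matrix (Fin n) (Fin n) ℝ => slotMetric v A i j) A := by
  cases v
  · exact contDiffAt_matrix_inv hA i j
  · exact (contDiff_matrix_entry i j).contDiffAt

theorem differentiableAt_matrix {g : Euc n → Matrix (Fin n) (Fin n) ℝ} {p : Euc n}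
    (hg : ∀ i j, DifferentiableAt ℝ (fun q => g q i j) p) : DifferentiableAt ℝ g p :=
  differentiableAt_pi.2 fun i => differentiableAt_pi.2 fun j => hg i j

theorem differentiableAt_slotMetric {g : Euc n → Matrix (Fin n) (Fin n) ℝ} {p : Euc n}
    (hg : ∀ i j, DifferentiableAt ℝ (fun q => g q i j) p) (hp : (g p).det ≠ 0)
    (v : Variance) (i j : Fin n) :
    DifferentiableAt ℝ (fun q => slotMetric v (g q) i j) p :=
  ((contDiffAt_slotMetric (N := 1) hp v i j).differentiableAt (by simp)).comp p
    (differentiableAt_matrix hg)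

/-! ### Compatibility of the covariant derivative with the metric -/

/-- The matrix by which the covariant derivative acts on an index slot of type `v`. -/
noncomputable def connectionForm (v : Variance) (g : Euc n → Matrix (Fin n) (Fin n) ℝ) (p : Euc n)
    (k i l : Fin n) : ℝ :=
  match v with
  | .contravariant => christoffel g p i k l
  | .covariant => - christoffel g p l k i

theorem covDeriv_eq (ε : Fin m → Variance) (g : Euc n → Matrix (Fin n) (Fin n) ℝ)
    (u : Euc n → Tensor n m) (p : Euc n) (k : Fin n) (I : Fin m → Fin n) :
    covDeriv ε g u p k I = pderiv k (fun q => u q I) p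
      + ∑ a, ∑ l, connectionForm (ε a) g p k (I a) l * u p (Function.update I a l) := rfl

/-- Lowering the upper index cancels the inverse metric and leaves the Christoffel symbols of the
first kind. -/
theorem sum_mul_christoffel {g : Euc n → Matrix (Fin n) (Fin n) ℝ} {p : Euc n}
    (hp : (g p).det ≠ 0) (k l j : Fin n) :
    ∑ i, g p j i * christoffel g p i k l = (1 / 2) * (pderiv k (fun q => g q l j) p
      + pderiv l (fun q => g q k j) p - pderiv j (fun q => g q k l) p) := by
  set e : Fin n → ℝ := fun b => pderiv k (fun q => g q l b) p
      + pderiv l (fun q => g q k b) p - pderiv b (fun q => g q k l) p with he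
  have h1 : ∀ i, christoffel g p i k l = (1 / 2) * ((g p)⁻¹.mulVec e) i := fun i => rfl
  have h2 : (g p).mulVec ((g p)⁻¹.mulVec e) = e := by
    rw [Matrix.mulVec_mulVec, Matrix.mul_nonsing_inv _ (isUnit_iff_ne_zero.2 hp), Matrix.one_mulVec]
  have h3 := congrFun h2 j
  simp only [Matrix.mulVec, dotProduct] at h3 h1
  simp_rw [h1]
  rw [show e j = pderiv k (fun q => g q l j) p
      + pderiv l (fun q => g q k j) p - pderiv j (fun q => g q k l) p from rfl] at h3
  rw [← h3, Finset.mul_sum]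
  refine Finset.sum_congr rfl fun i _ => by ring

/-- This is `∇g = 0` in coordinates: in the sum of two symbols of the first kind all but one
derivative cancel. Symmetry of `g` is needed near `p` and not only at `p`, because it is
differentiated. -/
theorem pderiv_metric_eq {g : Euc n → Matrix (Fin n) (Fin n) ℝ} {p : Euc n}
    (hsymm : ∀ᶠ q in 𝓝 p, (g q).IsSymm) (hp : (g p).det ≠ 0) (k i j : Fin n) :
    pderiv k (fun q => g q i j) p
      = ∑ l, (christoffel g p l k i * g p l j + g p i l * christoffel g p l k j) := by
  have hs : ∀ a b : Fin n, (fun q => g q a b) =ᶠ[𝓝 p] fun q => g q b a := fun a b => by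
    filter_upwards [hsymm] with q hq using hq.apply b a
  have h1 : ∀ l, christoffel g p l k i * g p l j = g p j l * christoffel g p l k i := fun l => by
    rw [hsymm.self_of_nhds.apply j l, mul_comm]
  simp_rw [Finset.sum_add_distrib, h1]
  rw [sum_mul_christoffel hp, sum_mul_christoffel hp, (hs j i).pderiv_eq k, (hs k i).pderiv_eq j,
    (hs k j).pderiv_eq i]
  rw [(hs i k).pderiv_eq j, (hs j k).pderiv_eq i]
  ring

theorem pderiv_matrix_inv {g : Euc n → Matrix (Fin n) (Fin n) ℝ} {p : Euc n}
    (hg : ∀ i j, DifferentiableAt ℝ (fun q => g q i j) p) (hdet : ∀ᶠ q in 𝓝 p, (g q).det ≠ 0)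
    (k i j : Fin n) :
    pderiv k (fun q => (g q)⁻¹ i j) p
      = - ∑ a, ∑ b, (g p)⁻¹ i a * pderiv k (fun q => g q a b) p * (g p)⁻¹ b j := by
  have hp := hdet.self_of_nhds
  have hinv : ∀ a b, DifferentiableAt ℝ (fun q => (g q)⁻¹ a b) p := fun a b =>
    differentiableAt_slotMetric hg hp .covariant a b
  let dG : Matrix (Fin n) (Fin n) ℝ := Matrix.of fun a b => pderiv k (fun q => g q a b) p
  let dI : Matrix (Fin n) (Fin n) ℝ := Matrix.of fun a b => pderiv k (fun q => (g q)⁻¹ a b) p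
  have h1 : dG * (g p)⁻¹ + g p * dI = 0 := by
    ext a b
    have e1 : (fun q => ∑ c, g q a c * (g q)⁻¹ c b) =ᶠ[𝓝 p] fun _ => (1 : Matrix _ _ ℝ) a b := by
      filter_upwards [hdet] with q hq
      rw [← Matrix.mul_apply, Matrix.mul_nonsing_inv _ (isUnit_iff_ne_zero.2 hq)]
    have e2 := e1.pderiv_eq k
    rw [pderiv_const, pderiv_sum _ _ fun c _ => (hg a c).fun_mul (hinv c b)] at e2
    simp_rw [pderiv_mul k (hg a _) (hinv _ b), Finset.sum_add_distrib] at e2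
    simpa [Matrix.mul_apply, dG, dI] using e2
  have h2 : dI = - ((g p)⁻¹ * dG * (g p)⁻¹) := by
    have := congrArg (fun X => (g p)⁻¹ * X) h1
    simp only [Matrix.mul_add, Matrix.mul_zero] at this
    rw [Matrix.nonsing_inv_mul_cancel_left _ _ (isUnit_iff_ne_zero.2 hp), ← Matrix.mul_assoc] at this
    exact eq_neg_of_add_eq_zero_right this
  have h3 := congrFun (congrFun h2 i) j
  change dI i j = _
  rw [h3, Matrix.neg_apply, Matrix.mul_apply]
  simp_rw [Matrix.mul_apply, Finset.sum_mul]
  rw [Finset.sum_comm]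
  rfl

/-- For a covariant slot, conjugating `∂g = Γᵀ g + g Γ` by the inverse metric turns `∇g = 0` into
`∇g⁻¹ = 0`. Both types of slot then obey one formula, with the connection acting by
`connectionForm`. -/
theorem pderiv_slotMetric {g : Euc n → Matrix (Fin n) (Fin n) ℝ} {p : Euc n}
    (hg : ∀ i j, DifferentiableAt ℝ (fun q => g q i j) p)
    (hpos : ∀ᶠ q in 𝓝 p, (g q).PosDef) (v : Variance) (k i j : Fin n) :
    pderiv k (fun q => slotMetric v (g q) i j) p
      = ∑ l, (connectionForm v g p k l i * slotMetric v (g p) l j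
          + slotMetric v (g p) i l * connectionForm v g p k l j) := by
  have hsymm : ∀ᶠ q in 𝓝 p, (g q).IsSymm := hpos.mono fun q hq => by
    ext i j; simpa using hq.isHermitian.apply i j
  have hdet : ∀ᶠ q in 𝓝 p, (g q).det ≠ 0 := hpos.mono fun q hq => hq.det_pos.ne'
  have hp := hdet.self_of_nhds
  have hu := isUnit_iff_ne_zero.2 hp
  cases v
  · change pderiv k (fun q => (g q)⁻¹ i j) p
      = ∑ l, (- christoffel g p i k l * (g p)⁻¹ l j + (g p)⁻¹ i l * (- christoffel g p j k l))
    rw [pderiv_matrix_inv hg hdet]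
    let Γ : Matrix (Fin n) (Fin n) ℝ := Matrix.of fun a b => christoffel g p a k b
    have e1 : (Matrix.of fun a b => pderiv k (fun q => g q a b) p)
        = Γ.transpose * g p + g p * Γ := by
      ext a b
      rw [Matrix.of_apply, pderiv_metric_eq hsymm hp, Finset.sum_add_distrib]
      simp [Matrix.mul_apply, Matrix.add_apply, Γ]
    have e2 : (g p)⁻¹ * (Γ.transpose * g p + g p * Γ) * (g p)⁻¹
        = (g p)⁻¹ * Γ.transpose + Γ * (g p)⁻¹ := by
      rw [Matrix.mul_add, Matrix.nonsing_inv_mul_cancel_left _ _ hu, Matrix.add_mul,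
        ← Matrix.mul_assoc, Matrix.mul_nonsing_inv_cancel_right _ _ hu]
    rw [← e1] at e2
    have e3 := congrFun (congrFun e2 i) j
    simp only [Matrix.mul_apply, Matrix.add_apply, Finset.sum_mul, Matrix.transpose_apply,
      Matrix.of_apply] at e3
    rw [Finset.sum_comm, e3, ← Finset.sum_add_distrib, ← Finset.sum_neg_distrib]
    refine Finset.sum_congr rfl fun l _ => ?_
    simp only [Γ, Matrix.of_apply]; ring
  · exact pderiv_metric_eq hsymm hp k i j

/-- The map exchanging `l` with the entry `I a` is an involution on pairs `(I, l)`. -/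
theorem sum_sum_update {β : Type*} [AddCommMonoid β] (a : Fin m)
    (f : (Fin m → Fin n) → Fin n → β) :
    ∑ I, ∑ l, f I l = ∑ I : Fin m → Fin n, ∑ l, f (Function.update I a l) (I a) := by
  rw [← Finset.sum_product', ← Finset.sum_product']
  refine Finset.sum_nbij' (fun x => (Function.update x.1 a x.2, x.1 a))
    (fun x => (Function.update x.1 a x.2, x.1 a)) ?_ ?_ ?_ ?_ ?_ <;> simp

/-- Exchanging the contracted index with the one in slot `a` moves the connection from the
components of `S` onto the metric factor of that slot. This is the form in which the Leibniz rule
for the product of slot metrics produces it. -/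
theorem tensorInner_connection {G : Matrix (Fin n) (Fin n) ℝ} (ε : Fin m → Variance)
    (N : Fin m → Fin n → Fin n → ℝ) (S T : Tensor n m) :
    tensorInner ε G (fun I => ∑ a, ∑ l, N a (I a) l * S (Function.update I a l)) T
      = ∑ I, ∑ J, (∑ a, (∏ b ∈ Finset.univ.erase a, slotMetric (ε b) G (I b) (J b))
          * ∑ l, N a l (I a) * slotMetric (ε a) G l (J a)) * S I * T J := by
  have h1 : tensorInner ε G (fun I => ∑ a, ∑ l, N a (I a) l * S (Function.update I a l)) T
      = ∑ J, ∑ a, ∑ I, ∑ l, (∏ b, slotMetric (ε b) G (I b) (J b))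
          * (N a (I a) l * S (Function.update I a l)) * T J := by
    rw [tensorInner, Finset.sum_comm]
    refine Finset.sum_congr rfl fun J _ => ?_
    rw [Finset.sum_comm]
    refine Finset.sum_congr rfl fun I _ => ?_
    simp_rw [Finset.mul_sum, Finset.sum_mul]
  rw [h1]
  conv_rhs => rw [Finset.sum_comm]
  refine Finset.sum_congr rfl fun J _ => ?_
  simp_rw [Finset.sum_mul]
  conv_rhs => rw [Finset.sum_comm]
  refine Finset.sum_congr rfl fun a _ => ?_
  rw [sum_sum_update a]
  refine Finset.sum_congr rfl fun I _ => ?_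
  simp_rw [Finset.mul_sum, Finset.sum_mul]
  refine Finset.sum_congr rfl fun l _ => ?_
  rw [← Finset.mul_prod_erase _ _ (Finset.mem_univ a)]
  have h2 : ∏ b ∈ Finset.univ.erase a, slotMetric (ε b) G (Function.update I a l b) (J b)
      = ∏ b ∈ Finset.univ.erase a, slotMetric (ε b) G (I b) (J b) :=
    Finset.prod_congr rfl fun b hb => by rw [Function.update_of_ne (Finset.ne_of_mem_erase hb)]
  rw [h2]
  simp only [Function.update_self, Function.update_idem, Function.update_eq_self]
  ring

theorem tensorInner_add_left {G : Matrix (Fin n) (Fin n) ℝ} (ε : Fin m → Variance)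
    (S S' T : Tensor n m) :
    tensorInner ε G (fun I => S I + S' I) T = tensorInner ε G S T + tensorInner ε G S' T := by
  simp only [tensorInner, ← Finset.sum_add_distrib]
  refine Finset.sum_congr rfl fun I _ => Finset.sum_congr rfl fun J _ => by ring

theorem tensorInner_connection_right {G : Matrix (Fin n) (Fin n) ℝ} (hG : G.PosDef)
    (ε : Fin m → Variance) (N : Fin m → Fin n → Fin n → ℝ) (S T : Tensor n m) :
    tensorInner ε G (fun I => ∑ a, ∑ l, N a (I a) l * S (Function.update I a l)) T
      = ∑ I, ∑ J, (∑ a, (∏ b ∈ Finset.univ.erase a, slotMetric (ε b) G (I b) (J b))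
          * ∑ l, slotMetric (ε a) G (I a) l * N a l (J a)) * T I * S J := by
  have hs : ∀ v : Variance, ∀ i j, slotMetric v G i j = slotMetric v G j i := fun v i j => by
    simpa using ((slotMetric_posDef hG v).isHermitian.apply i j).symm
  rw [tensorInner_connection, Finset.sum_comm]
  refine Finset.sum_congr rfl fun I _ => Finset.sum_congr rfl fun J _ => ?_
  have : ∀ a, (∏ b ∈ Finset.univ.erase a, slotMetric (ε b) G (J b) (I b))
      * ∑ l, N a l (J a) * slotMetric (ε a) G l (I a)
      = (∏ b ∈ Finset.univ.erase a, slotMetric (ε b) G (I b) (J b))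
        * ∑ l, slotMetric (ε a) G (I a) l * N a l (J a) := fun a => by
    congr 1
    · exact Finset.prod_congr rfl fun b _ => hs _ _ _
    · exact Finset.sum_congr rfl fun l _ => by rw [hs _ l, mul_comm]
  simp_rw [this]
  ring

/-- The Levi-Civita derivative is compatible with the metric. -/
theorem pderiv_normSq {g : Euc n → Matrix (Fin n) (Fin n) ℝ} {p : Euc n}
    (hg : ∀ i j, DifferentiableAt ℝ (fun q => g q i j) p)
    (hpos : ∀ᶠ q in 𝓝 p, (g q).PosDef) (ε : Fin m → Variance) {u : Euc n → Tensor n m}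
    (hu : ∀ I, DifferentiableAt ℝ (fun q => u q I) p) (k : Fin n) :
    pderiv k (normSq ε g u) p = 2 * tensorInner ε (g p) (covDeriv ε g u p k) (u p) := by
  have hG := hpos.self_of_nhds
  have hS : ∀ v i j, DifferentiableAt ℝ (fun q => slotMetric v (g q) i j) p := fun v i j =>
    differentiableAt_slotMetric hg hG.det_pos.ne' v i j
  have hP : ∀ I J : Fin m → Fin n,
      DifferentiableAt ℝ (fun q => ∏ a, slotMetric (ε a) (g q) (I a) (J a)) p := fun I J =>
    (HasFDerivAt.finsetProd (u := Finset.univ)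
      fun a _ => (hS (ε a) (I a) (J a)).hasFDerivAt).differentiableAt
  have h1 : pderiv k (normSq ε g u) p = ∑ I, ∑ J,
      ((pderiv k (fun q => ∏ a, slotMetric (ε a) (g q) (I a) (J a)) p * u p I
        + (∏ a, slotMetric (ε a) (g p) (I a) (J a)) * pderiv k (fun q => u q I) p) * u p J
        + (∏ a, slotMetric (ε a) (g p) (I a) (J a)) * u p I * pderiv k (fun q => u q J) p) := by
    change pderiv k (fun q => ∑ I, ∑ J, (∏ a, slotMetric (ε a) (g q) (I a) (J a)) * u q I * u q J) p
      = _
    rw [pderiv_sum _ _ fun I _ => DifferentiableAt.fun_sum fun J _ => ((hP I J).fun_mul (hu I)).fun_mul (hu J)]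
    refine Finset.sum_congr rfl fun I _ => ?_
    rw [pderiv_sum _ _ fun J _ => ((hP I J).fun_mul (hu I)).fun_mul (hu J)]
    refine Finset.sum_congr rfl fun J _ => ?_
    rw [pderiv_mul k ((hP I J).fun_mul (hu I)) (hu J), pderiv_mul k (hP I J) (hu I)]
  set N : Fin m → Fin n → Fin n → ℝ := fun a => connectionForm (ε a) g p k with hN
  have h2 : covDeriv ε g u p k = fun I => pderiv k (fun q => u q I) p
      + ∑ a, ∑ l, N a (I a) l * u p (Function.update I a l) := rfl
  -- Each slot metric contributes a connection term on its left index and one on its right index.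
  -- The two resulting sums are those of `h5` and `h6`, so both equal the connection part of `⟨∇ₖu,
  -- u⟩`.
  have h3 : ∀ I J : Fin m → Fin n, pderiv k (fun q => ∏ a, slotMetric (ε a) (g q) (I a) (J a)) p
      = (∑ a, (∏ b ∈ Finset.univ.erase a, slotMetric (ε b) (g p) (I b) (J b))
          * ∑ l, N a l (I a) * slotMetric (ε a) (g p) l (J a))
        + ∑ a, (∏ b ∈ Finset.univ.erase a, slotMetric (ε b) (g p) (I b) (J b))
          * ∑ l, slotMetric (ε a) (g p) (I a) l * N a l (J a) := fun I J => by
    rw [pderiv_prod _ _ fun a _ => hS _ _ _, ← Finset.sum_add_distrib]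
    refine Finset.sum_congr rfl fun a _ => ?_
    rw [pderiv_slotMetric hg hpos, Finset.sum_add_distrib, mul_add]
  have h4 : tensorInner ε (g p) (covDeriv ε g u p k) (u p)
      = tensorInner ε (g p) (fun I => pderiv k (fun q => u q I) p) (u p)
        + tensorInner ε (g p) (fun I => ∑ a, ∑ l, N a (I a) l * u p (Function.update I a l)) (u p) := by
    rw [h2, tensorInner_add_left]
  have h5 := tensorInner_connection (G := g p) ε N (u p) (u p)
  have h6 := tensorInner_connection_right hG ε N (u p) (u p)
  have h7 := tensorInner_comm hG ε (fun I => pderiv k (fun q => u q I) p) (u p)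
  have h8 : pderiv k (normSq ε g u) p
      = (∑ I, ∑ J, (∑ a, (∏ b ∈ Finset.univ.erase a, slotMetric (ε b) (g p) (I b) (J b))
          * ∑ l, N a l (I a) * slotMetric (ε a) (g p) l (J a)) * u p I * u p J)
        + (∑ I, ∑ J, (∑ a, (∏ b ∈ Finset.univ.erase a, slotMetric (ε b) (g p) (I b) (J b))
          * ∑ l, slotMetric (ε a) (g p) (I a) l * N a l (J a)) * u p I * u p J)
        + tensorInner ε (g p) (fun I => pderiv k (fun q => u q I) p) (u p)
        + tensorInner ε (g p) (u p) (fun I => pderiv k (fun q => u q I) p) := by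
    rw [h1]
    simp only [tensorInner, ← Finset.sum_add_distrib]
    refine Finset.sum_congr rfl fun I _ => Finset.sum_congr rfl fun J _ => ?_
    rw [h3]; ring
  rw [h8, ← h5, ← h6, ← h7, h4]
  ring

theorem normSq_nonneg {g : Euc n → Matrix (Fin n) (Fin n) ℝ} {p : Euc n} (hg : (g p).PosDef)
    (ε : Fin m → Variance) (u : Euc n → Tensor n m) : 0 ≤ normSq ε g u p :=
  tensorInner_self_nonneg hg ε _

/-! ### Locally Lipschitz functions -/

section Lipschitz

variable {α : Type*} [PseudoMetricSpace α] {s : Set α}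

theorem locallyLipschitzOn_pi {ι : Type*} [Fintype ι] {F : ι → Type*}
    [∀ i, PseudoMetricSpace (F i)] {f : α → ∀ i, F i}
    (hf : ∀ i, LocallyLipschitzOn s fun p => f p i) : LocallyLipschitzOn s f := by
  intro p hp
  choose K t ht hKt using fun i => hf i hp
  refine ⟨∑ i, K i, ⋂ i, t i, Filter.iInter_mem.2 ht, fun a ha b hb => ?_⟩
  refine edist_pi_le_iff.2 fun i => ?_
  refine (hKt i (mem_iInter.1 ha i) (mem_iInter.1 hb i)).trans ?_
  gcongr
  exact Finset.single_le_sum (f := K) (fun _ _ => zero_le) (Finset.mem_univ i)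

theorem _root_.LocallyLipschitzOn.prodMk_on {β γ : Type*} [PseudoMetricSpace β]
    [PseudoMetricSpace γ] {f : α → β} {h : α → γ} (hf : LocallyLipschitzOn s f)
    (hh : LocallyLipschitzOn s h) : LocallyLipschitzOn s fun p => (f p, h p) := by
  intro p hp
  obtain ⟨K, t, ht, hK⟩ := hf hp
  obtain ⟨K', t', ht', hK'⟩ := hh hp
  exact ⟨max K K', t ∩ t', inter_mem ht ht',
    (hK.mono inter_subset_left).prodMk (hK'.mono inter_subset_right)⟩

theorem _root_.LocallyLipschitzOn.contDiffAt_comp {F G : Type*} [NormedAddCommGroup F]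
    [NormedSpace ℝ F] [NormedAddCommGroup G] [NormedSpace ℝ G] {f : α → F} {h : F → G}
    (hf : LocallyLipschitzOn s f) (hh : ∀ p ∈ s, ContDiffAt ℝ 1 h (f p)) :
    LocallyLipschitzOn s fun p => h (f p) := by
  intro p hp
  obtain ⟨K, t, ht, hK⟩ := hf hp
  obtain ⟨K', t', ht', hK'⟩ := (hh p hp).exists_lipschitzOnWith
  have hc := hf.continuousOn p hp
  exact ⟨K' * K, t ∩ f ⁻¹' t', inter_mem ht (hc ht'),
    hK'.comp (hK.mono inter_subset_left) fun q hq => hq.2⟩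

theorem _root_.LocallyLipschitzOn.real_mul {f h : α → ℝ} (hf : LocallyLipschitzOn s f)
    (hh : LocallyLipschitzOn s h) : LocallyLipschitzOn s fun p => f p * h p :=
  (hf.prodMk_on hh).contDiffAt_comp (h := fun z : ℝ × ℝ => z.1 * z.2) fun _ _ =>
    (contDiff_fst.mul contDiff_snd).contDiffAt

theorem locallyLipschitzOn_of_contDiffAt {E F : Type*} [NormedAddCommGroup E] [NormedSpace ℝ E]
    [NormedAddCommGroup F] [NormedSpace ℝ F] {f : E → F} {s : Set E}
    (hf : ∀ p ∈ s, ContDiffAt ℝ 1 f p) : LocallyLipschitzOn s f := fun p hp => by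
  obtain ⟨K, t, ht, hK⟩ := (hf p hp).exists_lipschitzOnWith
  exact ⟨K, t, nhdsWithin_le_nhds ht, hK⟩

end Lipschitz

/-- Rademacher's theorem for locally Lipschitz functions on an open set. -/
theorem ae_differentiableAt_of_locallyLipschitzOn {Ω : Set (Euc n)} (hΩ : IsOpen Ω)
    {f : Euc n → ℝ} (hf : LocallyLipschitzOn Ω f) :
    ∀ᵐ p : Euc n, p ∈ Ω → DifferentiableAt ℝ f p := by
  have : volume {p : Euc n | p ∈ Ω ∧ ¬ DifferentiableAt ℝ f p} = 0 := by
    -- Near each point `f` coincides with a globally Lipschitz function, to which Rademacher's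
    -- theorem applies.
    refine measure_null_of_locally_null _ fun p hp => ?_
    obtain ⟨K, t, ht, hK⟩ := hf hp.1
    rw [hΩ.nhdsWithin_eq hp.1] at ht
    obtain ⟨h, hh, hfh⟩ := hK.extend_real
    refine ⟨{q | q ∈ Ω ∧ ¬ DifferentiableAt ℝ f q} ∩ interior t,
      inter_mem self_mem_nhdsWithin (mem_nhdsWithin_of_mem_nhds (interior_mem_nhds.2 ht)), ?_⟩
    refine measure_mono_null ?_ (ae_iff.1 (hh.ae_differentiableAt (μ := volume)))
    rintro q ⟨⟨-, hq⟩, hqt⟩ hd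
    refine hq (hd.congr_of_eventuallyEq ?_)
    filter_upwards [isOpen_interior.mem_nhds hqt] with y hy using hfh (interior_subset hy)
  rw [ae_iff]
  simpa using this

/-- Compactness gives a Lipschitz constant and a bound `M` on a ball exceeding `K` by a margin of
one. A point of `K` and a point outside this ball are at distance at least one, so `M` serves as a
Lipschitz constant for such a pair. -/
theorem exists_lipschitzWith_of_eq_zero {Ω K : Set (Euc n)} (hΩ : IsOpen Ω) (hK : IsCompact K)
    (hKΩ : K ⊆ Ω) {f : Euc n → ℝ} (hf : LocallyLipschitzOn Ω f) (h0 : ∀ p ∉ K, f p = 0) :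
    ∃ C, LipschitzWith C f := by
  have hloc : LocallyLipschitz f := by
    intro p
    by_cases hp : p ∈ K
    · obtain ⟨C, t, ht, hC⟩ := hf (hKΩ hp)
      exact ⟨C, t, by rwa [hΩ.nhdsWithin_eq (hKΩ hp)] at ht, hC⟩
    · refine ⟨0, Kᶜ, hK.isClosed.isOpen_compl.mem_nhds hp, fun a ha b hb => ?_⟩
      simp [h0 a ha, h0 b hb]
  obtain ⟨ρ, hρ⟩ := hK.isBounded.subset_closedBall 0
  have hB : IsCompact (Metric.closedBall (0 : Euc n) (ρ + 1)) := isCompact_closedBall _ _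
  obtain ⟨C, hC⟩ := (hloc.locallyLipschitzOn
    (s := Metric.closedBall (0 : Euc n) (ρ + 1))).exists_lipschitzOnWith_of_compact hB
  obtain ⟨M, hM⟩ := hB.exists_bound_of_continuousOn hloc.continuous.continuousOn
  have hfar : ∀ a b : Euc n, a ∈ Metric.closedBall (0 : Euc n) (ρ + 1) →
      b ∉ Metric.closedBall (0 : Euc n) (ρ + 1) →
      dist (f a) (f b) ≤ max C (Real.toNNReal M) * dist a b := by
    intro a b ha hb
    have hb' : f b = 0 := h0 b fun h => hb (Metric.closedBall_subset_closedBall (by linarith) (hρ h))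
    rw [hb', dist_zero_right]
    by_cases haK : a ∈ K
    · have h1 : 1 ≤ dist a b := by
        have h2 := hρ haK
        rw [Metric.mem_closedBall, dist_zero_right] at h2 hb
        have := norm_sub_norm_le b a
        rw [dist_comm, dist_eq_norm]; linarith
      have h3 : M ≤ (max C (Real.toNNReal M) : NNReal) := by
        rw [NNReal.coe_max]; exact (Real.le_coe_toNNReal M).trans (le_max_right _ _)
      calc ‖f a‖ ≤ M := hM a ha
        _ ≤ (max C (Real.toNNReal M) : NNReal) * 1 := by rwa [mul_one]
        _ ≤ _ := by gcongr
    · rw [h0 a haK, norm_zero]; positivity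
  refine ⟨max C (Real.toNNReal M), LipschitzWith.of_dist_le_mul fun a b => ?_⟩
  by_cases ha : a ∈ Metric.closedBall (0 : Euc n) (ρ + 1) <;>
    by_cases hb : b ∈ Metric.closedBall (0 : Euc n) (ρ + 1)
  · refine (hC.dist_le_mul a ha b hb).trans ?_
    gcongr
    exact le_max_left _ _
  · exact hfar a b ha hb
  · rw [dist_comm, dist_comm a b]; exact hfar b a hb ha
  · rw [h0 a fun h => ha (Metric.closedBall_subset_closedBall (by linarith) (hρ h)),
      h0 b fun h => hb (Metric.closedBall_subset_closedBall (by linarith) (hρ h)), dist_self]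
    positivity

/-! ### Integration of partial derivatives of Lipschitz functions -/

theorem measurable_pderiv (k : Fin n) (f : Euc n → ℝ) : Measurable (pderiv k f) :=
  measurable_fderiv_apply_const ℝ f _

theorem pderiv_eq_zero_of_notMem {K : Set (Euc n)} (hK : IsClosed K) {f : Euc n → ℝ}
    (h0 : ∀ p ∉ K, f p = 0) (k : Fin n) {p : Euc n} (hp : p ∉ K) : pderiv k f p = 0 := by
  have : f =ᶠ[𝓝 p] fun _ => 0 := by
    filter_upwards [hK.isOpen_compl.mem_nhds hp] with q hq using h0 q hq
  rw [this.pderiv_eq, pderiv_const]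

theorem abs_pderiv_le_of_lipschitzOn {f : Euc n → ℝ} {p : Euc n} {t : Set (Euc n)} (ht : t ∈ 𝓝 p)
    {C : NNReal} (hC : LipschitzOnWith C f t) (k : Fin n) : |pderiv k f p| ≤ C := by
  refine ((fderiv ℝ f p).le_opNorm _).trans ?_
  rw [PiLp.norm_single, norm_one, mul_one]
  exact norm_fderiv_le_of_lipschitzOn ℝ ht hC

/-- The partial derivatives of a compactly supported Lipschitz function are integrable, with
integral zero. -/
theorem integral_pderiv_eq_zero {Ω K : Set (Euc n)} (hΩ : IsOpen Ω) (hK : IsCompact K)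
    (hKΩ : K ⊆ Ω) {f : Euc n → ℝ} (hf : LocallyLipschitzOn Ω f) (h0 : ∀ p ∉ K, f p = 0)
    (k : Fin n) : Integrable (pderiv k f) ∧ ∫ p, pderiv k f p = 0 := by
  obtain ⟨C, hC⟩ := exists_lipschitzWith_of_eq_zero hΩ hK hKΩ hf h0
  have hcs : HasCompactSupport f := HasCompactSupport.intro hK h0
  constructor
  · have h1 : IntegrableOn (pderiv k f) K := by
      refine IntegrableOn.of_bound hK.measure_lt_top (measurable_pderiv k f).aestronglyMeasurable C
        (ae_of_all _ fun p => ?_)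
      exact abs_pderiv_le_of_lipschitzOn univ_mem (lipschitzOnWith_univ.2 hC) k
    exact h1.integrable_of_forall_notMem_eq_zero fun p hp =>
      pderiv_eq_zero_of_notMem hK.isClosed h0 k hp
  · have h1 := (LipschitzWith.const (1 : ℝ) : LipschitzWith 0 fun _ : Euc n => (1 : ℝ))
      |>.integral_lineDeriv_mul_eq (μ := volume) hC hcs (-EuclideanSpace.single k 1)
    simp only [lineDeriv, deriv_const, neg_neg, mul_one, zero_mul, integral_zero] at h1
    rw [h1]
    refine integral_congr_ae ?_
    filter_upwards [hC.ae_differentiableAt (μ := volume)] with p hp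
    exact (hp.lineDeriv_eq_fderiv).symm

/-! ### Uniform bounds on bounded parts of the domain -/

/-- Compactness of the part of `closure Ω` in the closed ball. The local bounds constrain only
points of `Ω`, because derivatives of functions smooth up to the boundary are controlled only there.
-/
theorem exists_bound_of_locally_bounded {Ω : Set (Euc n)} {f : Euc n → ℝ}
    (hf : ∀ p ∈ closure Ω, ∃ U ∈ 𝓝 p, ∃ C : ℝ, ∀ q ∈ U, q ∈ Ω → f q ≤ C) (ρ : ℝ) :
    ∃ C : ℝ, 0 < C ∧ ∀ q ∈ Ω, ‖q‖ ≤ ρ → f q ≤ C := by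
  have hK : IsCompact (closure Ω ∩ Metric.closedBall (0 : Euc n) ρ) :=
    (isCompact_closedBall _ _).inter_left isClosed_closure
  obtain ⟨C, hC⟩ := hK.induction_on (p := fun s => ∃ C : ℝ, ∀ q ∈ s, q ∈ Ω → f q ≤ C)
    ⟨0, by simp⟩ (fun s t hst ⟨C, hC⟩ => ⟨C, fun q hq => hC q (hst hq)⟩)
    (fun s t ⟨C, hC⟩ ⟨C', hC'⟩ => ⟨max C C', fun q hq hqΩ => hq.elim
      (fun h => (hC q h hqΩ).trans (le_max_left _ _))
      (fun h => (hC' q h hqΩ).trans (le_max_right _ _))⟩)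
    (fun p hp => by
      obtain ⟨U, hU, C, hC⟩ := hf p hp.1
      exact ⟨U, mem_nhdsWithin_of_mem_nhds hU, C, hC⟩)
  refine ⟨max C 1, by positivity, fun q hq hqρ => (hC q ⟨subset_closure hq, ?_⟩ hq).trans
    (le_max_left _ _)⟩
  simpa using hqρ

theorem locally_bounded_of_tendsto {Ω : Set (Euc n)} {f : Euc n → ℝ} {p : Euc n} {L : ℝ}
    (hf : Tendsto f (𝓝[Ω] p) (𝓝 L)) : ∃ U ∈ 𝓝 p, ∃ C : ℝ, ∀ q ∈ U, q ∈ Ω → f q ≤ C := by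
  have := hf.eventually (eventually_le_nhds (lt_add_one L))
  rw [eventually_nhdsWithin_iff] at this
  exact ⟨_, this, L + 1, fun q hq => hq⟩

theorem locally_bounded_pderiv {Ω : Set (Euc n)} (hΩ : IsOpen Ω) {f : Euc n → ℝ}
    (hf : LocallyLipschitzOn (closure Ω) f) (k : Fin n) :
    ∀ p ∈ closure Ω, ∃ U ∈ 𝓝 p, ∃ C : ℝ, ∀ q ∈ U, q ∈ Ω → |pderiv k f q| ≤ C := by
  intro p hp
  obtain ⟨C, t, ht, hC⟩ := hf hp
  obtain ⟨V, hV, hpV, hVt⟩ := mem_nhdsWithin.1 ht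
  refine ⟨V, hV.mem_nhds hpV, C, fun q hq hqΩ => abs_pderiv_le_of_lipschitzOn ?_ hC k⟩
  exact mem_of_superset ((hV.inter hΩ).mem_nhds ⟨hq, hqΩ⟩) fun y hy =>
    hVt ⟨hy.1, subset_closure hy.2⟩

/-- A function which is `C¹` up to the boundary has a derivative with limits at the boundary. -/
theorem exists_fderiv_eventuallyEq {F : Type*} [NormedAddCommGroup F] [NormedSpace ℝ F]
    {Ω s : Set (Euc n)} (hΩ : IsOpen Ω) (hs : Ω ⊆ s) {p : Euc n} (hp : p ∈ s) {f : Euc n → F}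
    {N : ℕ} (hf : ContDiffWithinAt ℝ (N + 1 : ℕ) f s p) :
    ∃ f' : Euc n → Euc n →L[ℝ] F, HasFDerivWithinAt f (f' p) s p ∧
      ContDiffWithinAt ℝ N f' s p ∧ ∀ᶠ q in 𝓝[Ω] p, fderiv ℝ f q = f' q := by
  have h := (contDiffWithinAt_succ_iff_hasFDerivWithinAt (n := (N : WithTop ℕ∞))
    (by exact_mod_cast WithTop.natCast_ne_top _)).1 (by exact_mod_cast hf)
  obtain ⟨u, hu, -, f', hf', hc⟩ := h
  rw [insert_eq_of_mem hp] at hu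
  refine ⟨f', ((hf' p (mem_of_mem_nhdsWithin hp hu)).mono_of_mem_nhdsWithin hu),
    hc.mono_of_mem_nhdsWithin hu, ?_⟩
  obtain ⟨V, hV, hpV, hVu⟩ := mem_nhdsWithin.1 hu
  filter_upwards [mem_nhdsWithin_of_mem_nhds (hV.mem_nhds hpV), self_mem_nhdsWithin] with q hqV hqΩ
  have : u ∈ 𝓝 q := mem_of_superset ((hV.inter hΩ).mem_nhds ⟨hqV, hqΩ⟩) fun y hy =>
    hVu ⟨hy.1, hs hy.2⟩
  exact ((hf' q (mem_of_mem_nhds this)).hasFDerivAt this).fderiv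

/-- Inside `Ω` the full derivative agrees with a derivative relative to `closure Ω` that is
continuous at `p`; repeating the argument once gives the second derivatives. -/
theorem exists_tendsto_fderiv {F : Type*} [NormedAddCommGroup F] [NormedSpace ℝ F]
    {Ω : Set (Euc n)} (hΩ : IsOpen Ω) {p : Euc n} (hp : p ∈ closure Ω) {f : Euc n → F}
    (hf : ContDiffWithinAt ℝ 2 f (closure Ω) p) :
    (∃ L : Euc n →L[ℝ] F, HasFDerivWithinAt f L (closure Ω) p ∧
      Tendsto (fderiv ℝ f) (𝓝[Ω] p) (𝓝 L)) ∧
    ∃ L₂, Tendsto (fderiv ℝ (fderiv ℝ f)) (𝓝[Ω] p) (𝓝 L₂) := by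
  obtain ⟨f', h1, h2, h3⟩ := exists_fderiv_eventuallyEq (N := 1) hΩ subset_closure hp
    (by exact_mod_cast hf)
  obtain ⟨f'', -, h5, h6⟩ := exists_fderiv_eventuallyEq (N := 0) hΩ subset_closure hp
    (by exact_mod_cast h2)
  refine ⟨⟨f' p, h1, ?_⟩, f'' p, ?_⟩
  · exact ((h2.continuousWithinAt.mono subset_closure).tendsto).congr' (h3.mono fun q hq => hq.symm)
  · refine ((h5.continuousWithinAt.mono subset_closure).tendsto).congr' ?_
    filter_upwards [h6, eventually_eventually_nhdsWithin.2 h3, self_mem_nhdsWithin]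
      with q hq hq3 hqΩ
    rw [hΩ.nhdsWithin_eq hqΩ] at hq3
    rw [← hq]
    exact (EventuallyEq.fderiv_eq hq3).symm

variable {Ω : Set (Euc n)} {R₀ : ℝ}

/-! ### Scaling -/

theorem IsScaleInvariantDomain.smul_mem (hΩ : IsScaleInvariantDomain Ω R₀) {p : Euc n} (hp : p ∈ Ω)
    (hpR : R₀ ≤ ‖p‖) {l : ℝ} (hl : 1 ≤ l) : l • p ∈ Ω := by
  have h1 : p ∈ Ω \ Metric.ball 0 R₀ := ⟨hp, by simpa using hpR⟩
  rw [hΩ.scaling] at h1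
  obtain ⟨q, hq, k, hk, rfl⟩ := h1
  have h2 : l • k • q ∈ Ω \ Metric.ball 0 R₀ := by
    rw [hΩ.scaling]
    exact ⟨q, hq, l * k, one_le_mul_of_one_le_of_one_le hl hk, by rw [smul_smul]⟩
  exact h2.1

theorem IsScaleInvariantDomain.exists_smul_eq (hΩ : IsScaleInvariantDomain Ω R₀) {ρ : ℝ}
    (hρ : R₀ ≤ ρ) {p : Euc n} (hp : p ∈ Ω) (hpρ : ρ ≤ ‖p‖) :
    ∃ q ∈ Ω, ‖q‖ = ρ ∧ ∃ l : ℝ, 1 ≤ l ∧ p = l • q := by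
  have hR := hΩ.one_le
  have h1 : p ∈ Ω \ Metric.ball 0 R₀ := ⟨hp, by simpa using hρ.trans hpρ⟩
  rw [hΩ.scaling] at h1
  obtain ⟨q, hq, k, hk, rfl⟩ := h1
  have hqn : ‖q‖ = R₀ := by simpa using hq.2
  have h0 : 0 < R₀ := by linarith
  have h0' : 0 < ρ := by linarith
  refine ⟨(ρ / R₀) • q, hΩ.smul_mem hq.1 hqn.ge ((one_le_div h0).2 hρ), ?_, k * R₀ / ρ, ?_, ?_⟩
  · rw [norm_smul, hqn, Real.norm_of_nonneg (by positivity)]; field_simp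
  · rw [norm_smul, hqn, Real.norm_of_nonneg (by positivity)] at hpρ
    exact (one_le_div h0').2 hpρ
  · rw [smul_smul]; congr 1; field_simp

/-- Degree-zero homogeneity reduces a global bound to the compact part `‖p‖ ≤ R₀ + 1`. The margin of
one is there because invariance is available for derivatives only at `R₀ < ‖p‖`, where the scaling
law holds in a neighbourhood. -/
theorem exists_bound_of_scale_invariant (hΩ : IsScaleInvariantDomain Ω R₀) {f : Euc n → ℝ}
    (hf : ∀ p ∈ closure Ω, ∃ U ∈ 𝓝 p, ∃ C : ℝ, ∀ q ∈ U, q ∈ Ω → f q ≤ C)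
    (hs : ∀ p ∈ Ω, R₀ < ‖p‖ → ∀ l : ℝ, 1 ≤ l → f (l • p) = f p) :
    ∃ C : ℝ, 0 < C ∧ ∀ p ∈ Ω, f p ≤ C := by
  obtain ⟨C, hC, h⟩ := exists_bound_of_locally_bounded hf (R₀ + 1)
  refine ⟨C, hC, fun p hp => ?_⟩
  rcases le_total ‖p‖ (R₀ + 1) with h1 | h1
  · exact h p hp h1
  · obtain ⟨q, hq, hqn, l, hl, rfl⟩ := hΩ.exists_smul_eq (by linarith) hp h1
    rw [hs q hq (by linarith) l hl]
    exact h q hq hqn.le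

theorem pderiv_smul {h : Euc n → ℝ} {q : Euc n} {l c : ℝ}
    (hd : DifferentiableAt ℝ h q) (hh : ∀ᶠ y in 𝓝 q, h (l • y) = c * h y) (k : Fin n) :
    l * pderiv k h (l • q) = c * pderiv k h q := by
  have h1 : (fun y => h (l • y)) =ᶠ[𝓝 q] fun y => c • h y := hh
  have h2 := h1.fderiv_eq (𝕜 := ℝ)
  rw [fderiv_comp_smul, fderiv_fun_const_smul hd] at h2
  simpa [pderiv] using congrArg (fun L => L (EuclideanSpace.single k 1)) h2

/-- Functions which are smooth up to the boundary of `Ω` and homogeneous of degree one at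
distances at least `R₀` from the origin. -/
structure IsHomogeneousAtInfinity (Ω : Set (Euc n)) (R₀ : ℝ) (h : Euc n → ℝ) : Prop where
  smooth : ContDiffOn ℝ ∞ h (closure Ω)
  scaling : ∀ p ∈ Ω, R₀ ≤ ‖p‖ → ∀ l : ℝ, 1 ≤ l → h (l • p) = l * h p

theorem IsScalingDefiningFunction.isHomogeneousAtInfinity {x : Euc n → ℝ}
    (hΩ : IsScaleInvariantDomain Ω R₀) (hx : IsScalingDefiningFunction Ω R₀ x) :
    IsHomogeneousAtInfinity Ω R₀ x := by
  refine ⟨hx.smooth, fun p hp hpR l hl => hx.scaling l hl p ⟨hp, by simpa using hpR⟩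
    ⟨hΩ.smul_mem hp hpR hl, ?_⟩⟩
  simp only [Metric.mem_ball, dist_zero_right, not_lt, norm_smul]
  rw [Real.norm_of_nonneg (by linarith)]
  nlinarith [norm_nonneg p]

theorem IsRadiusFunction.isHomogeneousAtInfinity {r : Euc n → ℝ}
    (hΩ : IsScaleInvariantDomain Ω R₀) (hr : IsRadiusFunction Ω R₀ r) :
    IsHomogeneousAtInfinity Ω R₀ r := by
  refine ⟨hr.smooth, fun p hp hpR l hl => ?_⟩
  have h1 : R₀ ≤ ‖l • p‖ := by
    rw [norm_smul, Real.norm_of_nonneg (by linarith)]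
    nlinarith [norm_nonneg p]
  rw [hr.eq_norm p ⟨hp, by simpa using hpR⟩,
    hr.eq_norm (l • p) ⟨hΩ.smul_mem hp hpR hl, by simpa using h1⟩, norm_smul,
    Real.norm_of_nonneg (by linarith)]

namespace IsHomogeneousAtInfinity

variable {h : Euc n → ℝ}

theorem contDiffAt (hh : IsHomogeneousAtInfinity Ω R₀ h) (hΩ : IsOpen Ω) {p : Euc n} (hp : p ∈ Ω) :
    ContDiffAt ℝ ∞ h p :=
  hh.smooth.contDiffAt (mem_of_superset (hΩ.mem_nhds hp) subset_closure)

theorem contDiffAt_pderiv (hh : IsHomogeneousAtInfinity Ω R₀ h) (hΩ : IsOpen Ω) {p : Euc n}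
    (hp : p ∈ Ω) (k : Fin n) : ContDiffAt ℝ 1 (pderiv k h) p :=
  (ContDiffAt.fderiv_right (n := ∞) (m := 1) (hh.contDiffAt hΩ hp)
    (by rw [one_add_one_eq_two]; exact ENat.LEInfty.out)).clm_apply
    contDiffAt_const

theorem eventually_scaling (hh : IsHomogeneousAtInfinity Ω R₀ h) (hΩ : IsOpen Ω) {p : Euc n}
    (hp : p ∈ Ω) (hpR : R₀ < ‖p‖) {l : ℝ} (hl : 1 ≤ l) : ∀ᶠ q in 𝓝 p, h (l • q) = l * h q := by
  filter_upwards [hΩ.mem_nhds hp, continuous_norm.continuousAt.eventually (lt_mem_nhds hpR)]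
    with q hq hqR using hh.scaling q hq hqR.le l hl

theorem pderiv_scaling (hh : IsHomogeneousAtInfinity Ω R₀ h) (hΩ : IsOpen Ω) {p : Euc n}
    (hp : p ∈ Ω) (hpR : R₀ < ‖p‖) {l : ℝ} (hl : 1 ≤ l) (k : Fin n) :
    pderiv k h (l • p) = pderiv k h p :=
  mul_left_cancel₀ (by linarith) (pderiv_smul ((hh.contDiffAt hΩ hp).differentiableAt (by simp))
    (hh.eventually_scaling hΩ hp hpR hl) k)

theorem pderiv_pderiv_scaling (hh : IsHomogeneousAtInfinity Ω R₀ h) (hΩ : IsOpen Ω) {p : Euc n}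
    (hp : p ∈ Ω) (hpR : R₀ < ‖p‖) {l : ℝ} (hl : 1 ≤ l) (k : Fin n) :
    l * pderiv k (pderiv k h) (l • p) = pderiv k (pderiv k h) p := by
  rw [pderiv_smul (c := 1) ((hh.contDiffAt_pderiv hΩ hp k).differentiableAt (by simp)) ?_ k, one_mul]
  filter_upwards [hΩ.mem_nhds hp, continuous_norm.continuousAt.eventually (lt_mem_nhds hpR)]
    with q hq hqR
  rw [hh.pderiv_scaling hΩ hq hqR hl, one_mul]

/-- Euler's relation. -/
theorem sum_pderiv_mul (hh : IsHomogeneousAtInfinity Ω R₀ h) (hΩ : IsOpen Ω) {p : Euc n}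
    (hp : p ∈ Ω) (hpR : R₀ < ‖p‖) : ∑ k, pderiv k h p * p k = h p := by
  have h1 : ∑ k, pderiv k h p * p k = fderiv ℝ h p p := by
    have h0 := congrArg (fderiv ℝ h p) ((EuclideanSpace.basisFun (Fin n) ℝ).sum_repr p)
    rw [map_sum] at h0
    rw [← h0]
    simp [pderiv, mul_comm]
  rw [h1]
  have hd : DifferentiableAt ℝ h ((1 : ℝ) • p) := by
    rw [one_smul]; exact (hh.contDiffAt hΩ hp).differentiableAt (by simp)
  have h2 : HasDerivAt (fun l : ℝ => h (l • p)) (fderiv ℝ h p p) 1 := by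
    have h3 : HasDerivAt (fun l : ℝ => l • p) ((1 : ℝ) • p) 1 := (hasDerivAt_id _).smul_const p
    have h4 := hd.hasFDerivAt.comp_hasDerivAt (1 : ℝ) h3
    rw [one_smul] at h4
    exact h4
  -- The scaling law holds for `l ≥ 1` only, so the derivatives at `1` are compared from the right.
  have h4 : HasDerivWithinAt (fun l : ℝ => h (l • p)) (h p) (Ici 1) 1 := by
    have : HasDerivWithinAt (fun l : ℝ => l * h p) (h p) (Ici 1) 1 := by
      simpa using ((hasDerivAt_id (1 : ℝ)).mul_const (h p)).hasDerivWithinAt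
    exact this.congr (fun l hl => hh.scaling p hp hpR.le l hl) (hh.scaling p hp hpR.le 1 le_rfl)
  exact (uniqueDiffWithinAt_Ici (1 : ℝ)).eq_deriv _ h2.hasDerivWithinAt h4

theorem exists_tendsto (hh : IsHomogeneousAtInfinity Ω R₀ h) (hΩ : IsOpen Ω) {p : Euc n}
    (hp : p ∈ closure Ω) :
    Tendsto h (𝓝[Ω] p) (𝓝 (h p)) ∧
    (∃ L : Euc n →L[ℝ] ℝ, HasFDerivWithinAt h L (closure Ω) p ∧
      ∀ k, Tendsto (pderiv k h) (𝓝[Ω] p) (𝓝 (L (EuclideanSpace.single k 1)))) ∧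
    ∃ L₂ : Fin n → ℝ, ∀ k, Tendsto (pderiv k (pderiv k h)) (𝓝[Ω] p) (𝓝 (L₂ k)) := by
  have hc := hh.smooth p hp
  obtain ⟨⟨L, hL, hLt⟩, L₂, hL₂⟩ := exists_tendsto_fderiv hΩ hp (hc.of_le ENat.LEInfty.out)
  refine ⟨(hc.continuousWithinAt.mono subset_closure).tendsto, ⟨L, hL, fun k => ?_⟩,
    fun k => L₂ (EuclideanSpace.single k 1) (EuclideanSpace.single k 1), fun k => ?_⟩
  · exact ((ContinuousLinearMap.apply ℝ ℝ (EuclideanSpace.single k (1 : ℝ))).continuous.tendsto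
      L).comp hLt
  · have h1 := ((ContinuousLinearMap.apply ℝ ℝ (EuclideanSpace.single k (1 : ℝ))).comp
      (ContinuousLinearMap.apply ℝ (Euc n →L[ℝ] ℝ) (EuclideanSpace.single k (1 : ℝ)))).continuous.tendsto
      L₂ |>.comp hL₂
    refine h1.congr' ?_
    filter_upwards [self_mem_nhdsWithin] with q hq
    have hd : DifferentiableAt ℝ (fderiv ℝ h) q :=
      (ContDiffAt.fderiv_right (n := ∞) (m := 1) (hh.contDiffAt hΩ hq)
        (by rw [one_add_one_eq_two]; exact ENat.LEInfty.out)).differentiableAt (by simp)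
    have e := fderiv_clm_apply hd (differentiableAt_const (EuclideanSpace.single k (1 : ℝ)))
    change _ = fderiv ℝ (fun y => fderiv ℝ h y (EuclideanSpace.single k 1)) q _
    rw [e]
    simp

theorem exists_pderiv_bound (hh : IsHomogeneousAtInfinity Ω R₀ h)
    (hΩ : IsScaleInvariantDomain Ω R₀) : ∃ C : ℝ, 0 < C ∧ ∀ p ∈ Ω, ∀ k, |pderiv k h p| ≤ C := by
  have : ∀ k, ∃ C : ℝ, 0 < C ∧ ∀ p ∈ Ω, |pderiv k h p| ≤ C := fun k => by
    refine exists_bound_of_scale_invariant hΩ (fun p hp => ?_) fun p hp hpR l hl => by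
      rw [hh.pderiv_scaling hΩ.isOpen hp hpR hl]
    obtain ⟨-, ⟨L, -, hL⟩, -⟩ := hh.exists_tendsto hΩ.isOpen hp
    exact locally_bounded_of_tendsto (hL k).abs
  choose C hC h using this
  refine ⟨1 + ∑ k, C k, by have := Finset.sum_nonneg fun k (_ : k ∈ Finset.univ) => (hC k).le
                           linarith, fun p hp k => ?_⟩
  have := Finset.single_le_sum (fun k _ => (hC k).le) (Finset.mem_univ k)
  linarith [h k p hp]

end IsHomogeneousAtInfinity

/-! ### Uniform bounds for the defining function and the radius function -/

theorem IsRadiusFunction.pos {r : Euc n → ℝ} (hr : IsRadiusFunction Ω R₀ r) {p : Euc n}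
    (hp : p ∈ Ω) : 0 < r p := by
  obtain ⟨c, hc, h⟩ := hr.bddBelow
  exact hc.trans_le (h p hp)

theorem IsRadiusFunction.pos_of_mem_closure {r : Euc n → ℝ} (hr : IsRadiusFunction Ω R₀ r)
    {p : Euc n} (hp : p ∈ closure Ω) : 0 < r p := by
  obtain ⟨c, hc, h⟩ := hr.bddBelow
  have : (𝓝[Ω] p).NeBot := mem_closure_iff_nhdsWithin_neBot.1 hp
  refine hc.trans_le (ge_of_tendsto ((hr.smooth.continuousOn p hp).mono subset_closure).tendsto ?_)
  filter_upwards [self_mem_nhdsWithin] with q hq using h q hq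

section

variable {x r : Euc n → ℝ}

theorem exists_ratio_bound (hΩ : IsScaleInvariantDomain Ω R₀)
    (hx : IsScalingDefiningFunction Ω R₀ x) (hr : IsRadiusFunction Ω R₀ r) :
    ∃ C : ℝ, 0 < C ∧ ∀ p ∈ Ω, x p / r p ≤ C := by
  have hxh := hx.isHomogeneousAtInfinity hΩ
  have hrh := hr.isHomogeneousAtInfinity hΩ
  refine exists_bound_of_scale_invariant hΩ (fun p hp => ?_) fun p hp hpR l hl => ?_
  · exact locally_bounded_of_tendsto ((hxh.exists_tendsto hΩ.isOpen hp).1.div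
      (hrh.exists_tendsto hΩ.isOpen hp).1 (hr.pos_of_mem_closure hp).ne')
  · rw [hxh.scaling p hp hpR.le l hl, hrh.scaling p hp hpR.le l hl,
      mul_div_mul_left _ _ (by linarith)]

theorem exists_laplacian_bound (hΩ : IsScaleInvariantDomain Ω R₀)
    (hx : IsScalingDefiningFunction Ω R₀ x) (hr : IsRadiusFunction Ω R₀ r) :
    ∃ C : ℝ, 0 < C ∧ ∀ p ∈ Ω, |r p * ∑ k, pderiv k (pderiv k x) p| ≤ C := by
  have hxh := hx.isHomogeneousAtInfinity hΩ
  have hrh := hr.isHomogeneousAtInfinity hΩ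
  refine exists_bound_of_scale_invariant hΩ (fun p hp => ?_) fun p hp hpR l hl => ?_
  · obtain ⟨-, -, L₂, hL₂⟩ := hxh.exists_tendsto hΩ.isOpen hp
    exact locally_bounded_of_tendsto ((hrh.exists_tendsto hΩ.isOpen hp).1.mul
      (tendsto_finsetSum _ fun k _ => hL₂ k)).abs
  · rw [hrh.scaling p hp hpR.le l hl, mul_comm l, mul_assoc, Finset.mul_sum]
    simp_rw [hxh.pderiv_pderiv_scaling hΩ.isOpen hp hpR hl]

/-- The gradient of a defining function is bounded below near the boundary, uniformly at
infinity. -/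
theorem exists_gradient_lower_bound (hΩ : IsScaleInvariantDomain Ω R₀)
    (hx : IsScalingDefiningFunction Ω R₀ x) (hr : IsRadiusFunction Ω R₀ r) :
    ∃ c : ℝ, 0 < c ∧ ∀ p ∈ Ω, x p / r p < c → c ≤ ∑ k, pderiv k x p ^ 2 := by
  have hxh := hx.isHomogeneousAtInfinity hΩ
  have hrh := hr.isHomogeneousAtInfinity hΩ
  -- The maximum of `x/r` and `|∇x|²` has degree zero at infinity and positive limits on `closure
  -- Ω`: the first entry is positive inside, the second on the boundary. A bound for its inverse is
  -- the required uniform lower bound.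
  have : ∃ C : ℝ, 0 < C ∧ ∀ p ∈ Ω, (max (x p / r p) (∑ k, pderiv k x p ^ 2))⁻¹ ≤ C := by
    refine exists_bound_of_scale_invariant hΩ (fun p hp => ?_) fun p hp hpR l hl => ?_
    · obtain ⟨hxt, ⟨L, hL, hLt⟩, -⟩ := hxh.exists_tendsto hΩ.isOpen hp
      refine locally_bounded_of_tendsto (((hxt.div (hrh.exists_tendsto hΩ.isOpen hp).1
        (hr.pos_of_mem_closure hp).ne').max
        (tendsto_finsetSum _ fun k _ => (hLt k).pow 2)).inv₀ (ne_of_gt ?_))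
      by_cases hpΩ : p ∈ Ω
      · exact lt_max_of_lt_left (div_pos (hx.pos p hpΩ) (hr.pos hpΩ))
      · have hpf : p ∈ frontier Ω := by rw [hΩ.isOpen.frontier_eq]; exact ⟨hp, hpΩ⟩
        refine lt_max_of_lt_right ?_
        -- `fderivWithin` is zero by definition as soon as zero is a derivative within the set, so
        -- uniqueness of that derivative is not needed.
        have hL0 : L ≠ 0 := by
          rintro rfl
          exact hx.deriv_ne_zero p hpf (by rw [fderivWithin, if_pos hL])
        obtain ⟨k, hk⟩ : ∃ k, L (EuclideanSpace.single k 1) ≠ 0 := by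
          by_contra! hall
          refine hL0 (ContinuousLinearMap.ext fun v => ?_)
          rw [← (EuclideanSpace.basisFun (Fin n) ℝ).sum_repr v]
          simp [hall]
        exact Finset.sum_pos' (fun _ _ => sq_nonneg _) ⟨k, Finset.mem_univ _, by positivity⟩
    · rw [hxh.scaling p hp hpR.le l hl, hrh.scaling p hp hpR.le l hl,
        mul_div_mul_left _ _ (by linarith)]
      simp_rw [hxh.pderiv_scaling hΩ.isOpen hp hpR hl]
  obtain ⟨C, hC, h⟩ := this
  refine ⟨C⁻¹, by positivity, fun p hp hpc => ?_⟩
  have h1 : 0 < max (x p / r p) (∑ k, pderiv k x p ^ 2) :=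
    lt_max_of_lt_left (div_pos (hx.pos p hp) (hr.pos hp))
  have h2 := (inv_le_comm₀ h1 hC).1 (h p hp)
  exact (le_max_iff.1 h2).resolve_left (not_le.2 hpc)

end

variable {g : Euc n → Matrix (Fin n) (Fin n) ℝ}

/-! ### Uniform bounds for the metric -/

theorem exists_forall_of_eventually_cobounded {P : Euc n → Prop}
    (h : ∀ᶠ p in Bornology.cobounded (Euc n) ⊓ 𝓟 Ω, P p) : ∃ ρ : ℝ, ∀ p ∈ Ω, ρ ≤ ‖p‖ → P p := by
  rw [eventually_inf_principal, ← comap_norm_atTop, eventually_comap] at h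
  obtain ⟨ρ, hρ⟩ := eventually_atTop.1 h
  exact ⟨ρ, fun p hp hpρ => hρ ‖p‖ hpρ p rfl hp⟩

theorem exists_forall_of_eventually_cobounded_ae {P : Euc n → Prop}
    (h : ∀ᶠ p in Bornology.cobounded (Euc n) ⊓ 𝓟 Ω ⊓ ae volume, P p) :
    ∃ ρ : ℝ, ∀ᵐ p : Euc n, p ∈ Ω → ρ ≤ ‖p‖ → P p := by
  obtain ⟨s, hs, t, ht, hst⟩ := mem_inf_iff.1 h
  obtain ⟨ρ, hρ⟩ := exists_forall_of_eventually_cobounded hs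
  refine ⟨ρ, ?_⟩
  filter_upwards [ht] with p hpt hp hpρ
  have : p ∈ s ∩ t := ⟨hρ p hp hpρ, hpt⟩
  rw [← hst] at this
  exact this

theorem exists_bound_of_continuousOn_of_tendsto {f : Euc n → ℝ} {L : ℝ}
    (hf : ContinuousOn f (closure Ω)) (hL : Tendsto f (Bornology.cobounded (Euc n) ⊓ 𝓟 Ω) (𝓝 L)) :
    ∃ C : ℝ, 0 < C ∧ ∀ p ∈ Ω, f p ≤ C := by
  obtain ⟨ρ, hρ⟩ := exists_forall_of_eventually_cobounded
    (hL.eventually (eventually_le_nhds (lt_add_one L)))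
  obtain ⟨C, hC, h⟩ := exists_bound_of_locally_bounded (Ω := Ω) (f := f) (fun p hp =>
    locally_bounded_of_tendsto ((hf p hp).mono subset_closure).tendsto) ρ
  refine ⟨max C (L + 1), lt_max_of_lt_left hC, fun p hp => ?_⟩
  rcases le_total ‖p‖ ρ with h1 | h1
  · exact (h p hp h1).trans (le_max_left _ _)
  · exact (hρ p hp h1).trans (le_max_right _ _)

namespace IsAsymptoticallyEuclideanMetric

theorem continuousOn (hg : IsAsymptoticallyEuclideanMetric Ω g) : ContinuousOn g (closure Ω) :=
  continuousOn_pi.2 fun i => continuousOn_pi.2 fun j => (hg.locLipschitz i j).continuousOn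

theorem tendsto (hg : IsAsymptoticallyEuclideanMetric Ω g) :
    Tendsto g (Bornology.cobounded (Euc n) ⊓ 𝓟 Ω) (𝓝 1) :=
  tendsto_pi_nhds.2 fun i => tendsto_pi_nhds.2 fun j => hg.tendsto_euclidean i j

theorem locallyLipschitzOn (hg : IsAsymptoticallyEuclideanMetric Ω g) :
    LocallyLipschitzOn Ω g :=
  (locallyLipschitzOn_pi fun i => locallyLipschitzOn_pi fun j => hg.locLipschitz i j).mono
    subset_closure

theorem eventually_posDef (hg : IsAsymptoticallyEuclideanMetric Ω g) (hΩ : IsOpen Ω) {p : Euc n}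
    (hp : p ∈ Ω) : ∀ᶠ q in 𝓝 p, (g q).PosDef := by
  filter_upwards [hΩ.mem_nhds hp] with q hq using hg.posDef q (subset_closure hq)

/-- The metric takes values in a compact set of positive definite matrices. -/
theorem exists_isCompact (hg : IsAsymptoticallyEuclideanMetric Ω g) :
    ∃ 𝒦 : Set (Matrix (Fin n) (Fin n) ℝ), IsCompact 𝒦 ∧ (∀ G ∈ 𝒦, G.PosDef) ∧
      ∀ p ∈ Ω, g p ∈ 𝒦 := by
  obtain ⟨Λ, -, hΛ⟩ := exists_bound_of_continuousOn_of_tendsto hg.continuousOn.norm hg.tendsto.norm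
  have hdet : Continuous fun G : Matrix (Fin n) (Fin n) ℝ => G.det := contDiff_matrix_det.continuous
    (n := 0)
  obtain ⟨c, hc, hcd⟩ := exists_bound_of_continuousOn_of_tendsto (Ω := Ω)
    (f := fun p => (g p).det⁻¹)
    ((hdet.comp_continuousOn hg.continuousOn).inv₀ fun p hp => (hg.posDef p hp).det_pos.ne')
    ((hdet.continuousAt.tendsto.comp hg.tendsto).inv₀ (by simp))
  -- Semidefiniteness is a closed condition, and the lower bound on the determinant upgrades it to
  -- definiteness.
  refine ⟨Metric.closedBall 0 Λ ∩ {G | c⁻¹ ≤ G.det ∧ G.PosSemidef}, ?_, ?_, ?_⟩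
  · have : ProperSpace (Matrix (Fin n) (Fin n) ℝ) :=
      inferInstanceAs (ProperSpace (Fin n → Fin n → ℝ))
    refine (isCompact_closedBall _ _).inter_right ((isClosed_le continuous_const hdet).inter ?_)
    have : {G : Matrix (Fin n) (Fin n) ℝ | G.PosSemidef}
        = {G | G.conjTranspose = G} ∩ ⋂ v : Fin n → ℝ, {G | 0 ≤ star v ⬝ᵥ G.mulVec v} := by
      ext G
      simp only [mem_ofPred_eq, mem_inter_iff, mem_iInter]
      exact Matrix.posSemidef_iff_dotProduct_mulVec
    change IsClosed {G : Matrix (Fin n) (Fin n) ℝ | G.PosSemidef}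
    rw [this]
    refine (isClosed_eq (by fun_prop) continuous_id).inter (isClosed_iInter fun v =>
      isClosed_le continuous_const ?_)
    exact Continuous.dotProduct continuous_const (Continuous.matrix_mulVec continuous_id continuous_const)
  · rintro G ⟨-, h1, h2⟩
    exact h2.posDef_iff_det_ne_zero.2 ((inv_pos.2 hc).trans_le h1).ne'
  · intro p hp
    have hpd := hg.posDef p (subset_closure hp)
    exact ⟨by simpa using hΛ p hp, (inv_le_comm₀ hpd.det_pos hc).1 (hcd p hp), hpd.posSemidef⟩

/-- Uniform ellipticity of the inverse metric. -/
theorem exists_ellipticity (hg : IsAsymptoticallyEuclideanMetric Ω g) :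
    ∃ c : ℝ, 0 < c ∧ ∀ p ∈ Ω, ∀ v : Fin n → ℝ,
      c * ∑ k, v k ^ 2 ≤ ∑ k, ∑ l, (g p)⁻¹ k l * (v k * v l) := by
  obtain ⟨𝒦, h𝒦, hpos, hmem⟩ := hg.exists_isCompact
  let S : Set (Euc n) := Metric.sphere 0 1
  have hS : IsCompact S := isCompact_sphere _ _
  let Q : Matrix (Fin n) (Fin n) ℝ × Euc n → ℝ := fun z =>
    ∑ k, ∑ l, (z.1)⁻¹ k l * (z.2 k * z.2 l)
  have hQ : ContinuousOn Q (𝒦 ×ˢ S) := by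
    refine continuousOn_finsetSum _ fun k _ => continuousOn_finsetSum _ fun l _ => ?_
    refine ContinuousOn.mul (fun z hz => ?_) (by fun_prop)
    exact ((contDiffAt_matrix_inv (N := 0) (hpos _ hz.1).det_pos.ne' k l).continuousAt.comp
      (f := Prod.fst) continuousAt_fst).continuousWithinAt
  have hQv : ∀ (G : Matrix (Fin n) (Fin n) ℝ) (v : Euc n),
      Q (G, v) = star (⇑v) ⬝ᵥ (G⁻¹).mulVec v := fun G v => by
    simp only [Q, dotProduct, Matrix.mulVec, Finset.mul_sum]
    refine Finset.sum_congr rfl fun k _ => Finset.sum_congr rfl fun l _ => ?_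
    simp; ring
  have hQpos : ∀ z ∈ 𝒦 ×ˢ S, 0 < Q z := by
    rintro ⟨G, v⟩ ⟨hG, hv⟩
    rw [hQv]
    refine (hpos G hG).inv.dotProduct_mulVec_pos fun h0 => ?_
    have : v = 0 := by ext i; exact congrFun h0 i
    simp [S, this] at hv
  obtain ⟨c, hc, hcQ⟩ := (h𝒦.prod hS).exists_forall_le' hQ hQpos
  refine ⟨c, hc, fun p hp v => ?_⟩
  let w : Euc n := WithLp.toLp 2 v
  have hw2 : ∑ k, v k ^ 2 = ‖w‖ ^ 2 := by simp [w, EuclideanSpace.norm_sq_eq]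
  rw [hw2]
  by_cases hw : w = 0
  · have : v = 0 := by
      ext i; exact congrArg (fun z : Euc n => z i) hw
    simp [hw, this]
  · have hwn : ‖w‖ ≠ 0 := norm_ne_zero_iff.2 hw
    have h1 := hcQ (g p, ‖w‖⁻¹ • w) ⟨hmem p hp, by simp [S, norm_smul, hwn]⟩
    have h2 : Q (g p, ‖w‖⁻¹ • w) = (‖w‖ ^ 2)⁻¹ * ∑ k, ∑ l, (g p)⁻¹ k l * (v k * v l) := by
      simp only [Q, Finset.mul_sum]
      refine Finset.sum_congr rfl fun k _ => Finset.sum_congr rfl fun l _ => ?_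
      simp [w]; ring
    rw [h2] at h1
    calc c * ‖w‖ ^ 2 ≤ ((‖w‖ ^ 2)⁻¹ * ∑ k, ∑ l, (g p)⁻¹ k l * (v k * v l)) * ‖w‖ ^ 2 := by gcongr
      _ = _ := by field_simp

theorem volDensity_pos (hg : IsAsymptoticallyEuclideanMetric Ω g) {p : Euc n} (hp : p ∈ Ω) :
    0 < volDensity g p :=
  Real.sqrt_pos.2 (hg.posDef p (subset_closure hp)).det_pos

theorem ae_differentiableAt (hg : IsAsymptoticallyEuclideanMetric Ω g) (hΩ : IsOpen Ω) :
    ∀ᵐ p : Euc n, p ∈ Ω → ∀ i j, DifferentiableAt ℝ (fun q => g q i j) p := by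
  have := ae_all_iff.2 fun i => ae_all_iff.2 fun j => ae_differentiableAt_of_locallyLipschitzOn hΩ
    ((hg.locLipschitz i j).mono subset_closure)
  filter_upwards [this] with p hp hpΩ i j using hp i j hpΩ

theorem contDiffAt_sqrt_det {N : WithTop ℕ∞} {G : Matrix (Fin n) (Fin n) ℝ} (hG : 0 < G.det) :
    ContDiffAt ℝ N (fun G : Matrix (Fin n) (Fin n) ℝ => Real.sqrt G.det) G :=
  contDiff_matrix_det.contDiffAt.sqrt hG.ne'

/-- The logarithmic derivative of the volume density is controlled by the first derivatives of the
metric. -/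
theorem exists_pderiv_volDensity_bound (hg : IsAsymptoticallyEuclideanMetric Ω g) :
    ∃ C : ℝ, 0 < C ∧ ∀ p ∈ Ω, (∀ i j, DifferentiableAt ℝ (fun q => g q i j) p) →
      ∀ (k : Fin n) (b : ℝ), (∀ i j, |pderiv k (fun q => g q i j) p| ≤ b) → 0 ≤ b →
        |pderiv k (volDensity g) p| ≤ C * b * volDensity g p := by
  obtain ⟨𝒦, h𝒦, hpos, hmem⟩ := hg.exists_isCompact
  let Ψ : (Fin n → Fin n → ℝ) → ℝ := fun G => Real.sqrt (Matrix.det G)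
  have hΨ : ContinuousOn (fun G : Fin n → Fin n → ℝ => ‖fderiv ℝ Ψ G‖ / Ψ G) 𝒦 := by
    intro G hG
    have hd := (hpos G hG).det_pos
    have h0 : ContDiffAt ℝ 1 Ψ G := contDiffAt_sqrt_det hd
    have h1 : ContDiffAt ℝ 0 (fderiv ℝ Ψ) G := h0.fderiv_right (by simp)
    exact (h1.continuousAt.norm.div (contDiffAt_sqrt_det (N := 0) hd).continuousAt
      (Real.sqrt_pos.2 hd).ne').continuousWithinAt
  obtain ⟨C, hC⟩ := h𝒦.exists_bound_of_continuousOn hΨ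
  refine ⟨max C 1, by positivity, fun p hp hd k b hb hb0 => ?_⟩
  have hD := hg.volDensity_pos hp
  have hdet := (hg.posDef p (subset_closure hp)).det_pos
  let g' : Euc n → Fin n → Fin n → ℝ := g
  have h1 : ‖fderiv ℝ Ψ (g' p)‖ ≤ max C 1 * volDensity g p := by
    have := (le_abs_self _).trans (hC (g p) (hmem p hp))
    exact ((div_le_iff₀ hD).1 this).trans (by gcongr; exact le_max_left _ _)
  have hgd : DifferentiableAt ℝ g' p := differentiableAt_matrix hd
  have hΨd : DifferentiableAt ℝ Ψ (g' p) :=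
    (contDiffAt_sqrt_det (N := 1) hdet).differentiableAt (by simp)
  have h2 : pderiv k (volDensity g) p = fderiv ℝ Ψ (g' p) (fderiv ℝ g' p (EuclideanSpace.single k 1)) := by
    change fderiv ℝ (Ψ ∘ g') p _ = _
    rw [fderiv_comp p hΨd hgd]
    rfl
  have h3 : ‖fderiv ℝ g' p (EuclideanSpace.single k 1)‖ ≤ b := by
    refine (pi_norm_le_iff_of_nonneg hb0).2 fun i => (pi_norm_le_iff_of_nonneg hb0).2 fun j => ?_
    have h4 : fderiv ℝ g' p (EuclideanSpace.single k 1) i j = pderiv k (fun q => g q i j) p := by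
      have h5 := ((ContinuousLinearMap.proj (R := ℝ) (φ := fun _ : Fin n => ℝ) j).comp
        (ContinuousLinearMap.proj (R := ℝ) (φ := fun _ : Fin n => Fin n → ℝ) i)).hasFDerivAt.comp p
          hgd.hasFDerivAt
      exact (congrArg (fun L : Euc n →L[ℝ] ℝ => L (EuclideanSpace.single k 1)) h5.fderiv).symm
    rw [h4]; exact hb i j
  rw [h2]
  calc |fderiv ℝ Ψ (g' p) (fderiv ℝ g' p (EuclideanSpace.single k 1))|
      ≤ ‖fderiv ℝ Ψ (g' p)‖ * ‖fderiv ℝ g' p (EuclideanSpace.single k 1)‖ :=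
        (fderiv ℝ Ψ (g' p)).le_opNorm _
    _ ≤ max C 1 * volDensity g p * b := by gcongr
    _ = _ := by ring

theorem exists_pderiv_volDensity_bound_inner (hg : IsAsymptoticallyEuclideanMetric Ω g)
    (hΩ : IsOpen Ω) (ρ : ℝ) :
    ∃ C : ℝ, 0 < C ∧ ∀ᵐ p : Euc n, p ∈ Ω → ‖p‖ ≤ ρ → ∀ k,
      |pderiv k (volDensity g) p| ≤ C * volDensity g p := by
  obtain ⟨C, hC, h⟩ := hg.exists_pderiv_volDensity_bound
  choose B hB hBk using fun i j k => exists_bound_of_locally_bounded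
    (locally_bounded_pderiv hΩ (hg.locLipschitz i j) k) ρ
  let b := 1 + ∑ i, ∑ j, ∑ k, B i j k
  have hBb : ∀ i j k, B i j k ≤ b := fun i j k => by
    have h1 := Finset.single_le_sum (f := fun k => B i j k) (fun k _ => (hB i j k).le)
      (Finset.mem_univ k)
    have h2 := Finset.single_le_sum (f := fun j => ∑ k, B i j k)
      (fun j _ => Finset.sum_nonneg fun k _ => (hB i j k).le) (Finset.mem_univ j)
    have h3 := Finset.single_le_sum (f := fun i => ∑ j, ∑ k, B i j k)
      (fun i _ => Finset.sum_nonneg fun j _ => Finset.sum_nonneg fun k _ => (hB i j k).le)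
      (Finset.mem_univ i)
    simp only [b] at *
    linarith
  have hb : 0 < b := add_pos_of_pos_of_nonneg one_pos <| Finset.sum_nonneg fun i _ =>
    Finset.sum_nonneg fun j _ => Finset.sum_nonneg fun k _ => (hB i j k).le
  refine ⟨C * b, by positivity, ?_⟩
  filter_upwards [hg.ae_differentiableAt hΩ] with p hp hpΩ hpρ k
  exact h p hpΩ (hp hpΩ) k b (fun i j => (hBk i j k p hpΩ hpρ).trans (hBb i j k)) hb.le

theorem exists_pderiv_volDensity_bound_outer (hg : IsAsymptoticallyEuclideanMetric Ω g)
    (hΩ : IsOpen Ω) {η : ℝ} (hη : 0 < η) :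
    ∃ ρ : ℝ, ∀ᵐ p : Euc n, p ∈ Ω → ρ ≤ ‖p‖ → ∀ k,
      |pderiv k (volDensity g) p| ≤ η / ‖p‖ * volDensity g p := by
  obtain ⟨C, hC, h⟩ := hg.exists_pderiv_volDensity_bound
  choose ρ hρ using fun i j k => exists_forall_of_eventually_cobounded_ae
    ((hg.deriv_isLittleO i j k).def (div_pos hη hC))
  refine ⟨∑ i, ∑ j, ∑ k, |ρ i j k|, ?_⟩
  have := ae_all_iff.2 fun i => ae_all_iff.2 fun j => ae_all_iff.2 fun k => hρ i j k
  filter_upwards [hg.ae_differentiableAt hΩ, this] with p hp hp2 hpΩ hpρ k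
  refine (h p hpΩ (hp hpΩ) k (η / C * ‖p‖⁻¹) (fun i j => ?_) (by positivity)).trans_eq (by field_simp)
  have h1 := Finset.single_le_sum (f := fun k => |ρ i j k|) (fun k _ => abs_nonneg _)
      (Finset.mem_univ k)
  have h2 := Finset.single_le_sum (f := fun j => ∑ k, |ρ i j k|)
    (fun j _ => Finset.sum_nonneg fun k _ => abs_nonneg _) (Finset.mem_univ j)
  have h3 := Finset.single_le_sum (f := fun i => ∑ j, ∑ k, |ρ i j k|)
    (fun i _ => Finset.sum_nonneg fun j _ => Finset.sum_nonneg fun k _ => abs_nonneg _)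
    (Finset.mem_univ i)
  simpa using hp2 i j k hpΩ (((le_abs_self _).trans (h1.trans (h2.trans h3))).trans hpρ)

end IsAsymptoticallyEuclideanMetric

/-! ### The weight and the vector field -/

/-- The weight `xᵃ rᵇ exp (-s r / x)`. -/
noncomputable def weight (a b s : ℝ) (x r : ℝ) : ℝ := x ^ a * r ^ b * Real.exp (-s * r / x)

theorem weight_pos (a b s : ℝ) {x r : ℝ} (hx : 0 < x) (hr : 0 < r) : 0 < weight a b s x r := by
  unfold weight; positivity

theorem weight_add (a b c d s : ℝ) {x r : ℝ} (hx : 0 < x) (hr : 0 < r) :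
    weight (a + c) (b + d) s x r = weight a b s x r * x ^ c * r ^ d := by
  simp only [weight, Real.rpow_add hx, Real.rpow_add hr]; ring

theorem contDiffAt_weight {N : WithTop ℕ∞} (a b s : ℝ) {x r : Euc n → ℝ} {p : Euc n}
    (hx : ContDiffAt ℝ N x p) (hr : ContDiffAt ℝ N r p) (hx0 : 0 < x p) (hr0 : 0 < r p) :
    ContDiffAt ℝ N (fun q => weight a b s (x q) (r q)) p :=
  ((hx.rpow_const_of_ne hx0.ne').mul (hr.rpow_const_of_ne hr0.ne')).mul
    (((contDiffAt_const.mul hr).div hx hx0.ne').exp)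

theorem pderiv_weight (a b s : ℝ) {x r : Euc n → ℝ} {p : Euc n} (hx : DifferentiableAt ℝ x p)
    (hr : DifferentiableAt ℝ r p) (hx0 : 0 < x p) (hr0 : 0 < r p) (k : Fin n) :
    pderiv k (fun q => weight a b s (x q) (r q)) p
      = weight a b s (x p) (r p) * (a / x p * pderiv k x p + b / r p * pderiv k r p
        - s / x p * pderiv k r p + s * r p / x p ^ 2 * pderiv k x p) := by
  have h1 := hx.hasFDerivAt.rpow_const (p := a) (Or.inl hx0.ne')
  have h2 := hr.hasFDerivAt.rpow_const (p := b) (Or.inl hr0.ne')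
  have h3 : HasFDerivAt (fun q => -s * r q / x q)
      ((-s / x p) • fderiv ℝ r p + (s * r p / x p ^ 2) • fderiv ℝ x p) p := by
    have := (hr.hasFDerivAt.const_mul (-s)).mul
      ((hasDerivAt_inv hx0.ne').comp_hasFDerivAt p hx.hasFDerivAt)
    refine (this.congr_fderiv ?_)
    ext v
    simp
    field_simp
    ring
  have h4 := ((h1.mul h2).mul h3.exp).fderiv
  change fderiv ℝ (fun q => x q ^ a * r q ^ b * Real.exp (-s * r q / x q)) p _ = _
  have h5 := congrArg (fun L : Euc n →L[ℝ] ℝ => L (EuclideanSpace.single k 1)) h4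
  refine h5.trans ?_
  simp only [_root_.add_apply, _root_.smul_apply, Pi.mul_apply, smul_eq_mul,
    Real.rpow_sub_one hx0.ne', Real.rpow_sub_one hr0.ne', weight, pderiv]
  field_simp
  ring

theorem pderiv_coord (k : Fin n) (p : Euc n) : pderiv k (fun q => q k) p = 1 := by
  have : HasFDerivAt (fun q : Euc n => q k) (EuclideanSpace.proj (𝕜 := ℝ) k) p :=
    (EuclideanSpace.proj (𝕜 := ℝ) k).hasFDerivAt
  rw [pderiv, this.fderiv]
  simp

theorem differentiableAt_coord (k : Fin n) (p : Euc n) : DifferentiableAt ℝ (fun q : Euc n => q k) p :=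
  (EuclideanSpace.proj (𝕜 := ℝ) k).differentiableAt

/-- The vector field `S x^{2σ+2} r^{2μ-1} e^{-sr/x} ∇x + E χ x^{2σ+2} r^{2μ-2} e^{-sr/x} p`. -/
noncomputable def carlemanField (x r χ : Euc n → ℝ) (s σ μ S E : ℝ) (k : Fin n) (p : Euc n) : ℝ :=
  S * (weight (2 * σ + 2) (2 * μ + -1) s (x p) (r p) * pderiv k x p)
    + E * (χ p * weight (2 * σ + 2) (2 * μ + -2) s (x p) (r p) * p k)

section

variable {x r χ : Euc n → ℝ} {p : Euc n}

theorem contDiffAt_carlemanField (hx : ContDiffAt ℝ ∞ x p) (hr : ContDiffAt ℝ ∞ r p)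
    (hχ : ContDiffAt ℝ 1 χ p) (hxk : ∀ k, ContDiffAt ℝ 1 (pderiv k x) p) (hx0 : 0 < x p)
    (hr0 : 0 < r p) (s σ μ S E : ℝ) (k : Fin n) :
    ContDiffAt ℝ 1 (carlemanField x r χ s σ μ S E k) p := by
  have hx1 : ContDiffAt ℝ 1 x p := hx.of_le ENat.LEInfty.out
  have hr1 : ContDiffAt ℝ 1 r p := hr.of_le ENat.LEInfty.out
  exact (contDiffAt_const.mul ((contDiffAt_weight _ _ _ hx1 hr1 hx0 hr0).mul (hxk k))).add
    (contDiffAt_const.mul ((hχ.mul (contDiffAt_weight _ _ _ hx1 hr1 hx0 hr0)).mul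
      (EuclideanSpace.proj (𝕜 := ℝ) k).contDiff.contDiffAt))

/-- The divergence of the vector field. -/
theorem sum_pderiv_carlemanField (hx : DifferentiableAt ℝ x p) (hr : DifferentiableAt ℝ r p)
    (hχ : DifferentiableAt ℝ χ p) (hxk : ∀ k, DifferentiableAt ℝ (pderiv k x) p) (hx0 : 0 < x p)
    (hr0 : 0 < r p) (hxs : χ p * ∑ k, pderiv k x p * p k = χ p * x p)
    (hrs : χ p * ∑ k, pderiv k r p * p k = χ p * r p) (s σ μ S E : ℝ) :
    ∑ k, pderiv k (carlemanField x r χ s σ μ S E k) p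
      = weight (2 * σ) (2 * μ) s (x p) (r p) *
        (S * (s * ∑ k, pderiv k x p ^ 2
          + x p / r p * ((2 * σ + 2) * ∑ k, pderiv k x p ^ 2 - s * ∑ k, pderiv k r p * pderiv k x p)
          + (x p / r p) ^ 2 * ((2 * μ - 1) * ∑ k, pderiv k r p * pderiv k x p
            + r p * ∑ k, pderiv k (pderiv k x) p))
        + E * ((x p / r p) ^ 2 * (χ p * (2 * (σ + μ + n / 2)) + ∑ k, pderiv k χ p * p k))) := by
  have hw : ∀ a b, DifferentiableAt ℝ (fun q => weight a b s (x q) (r q)) p := fun a b => by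
    simp only [weight, div_eq_mul_inv]
    exact ((hx.rpow_const (Or.inl hx0.ne')).fun_mul (hr.rpow_const (Or.inl hr0.ne'))).fun_mul
      (((differentiableAt_const _).fun_mul hr).fun_mul (hx.fun_inv hx0.ne')).exp
  set W₁ := weight (2 * σ + 2) (2 * μ + -1) s (x p) (r p) with hW₁
  set W₂ := weight (2 * σ + 2) (2 * μ + -2) s (x p) (r p) with hW₂
  set w := weight (2 * σ) (2 * μ) s (x p) (r p) with hw0
  have e1 : W₁ = w * (x p ^ 2 / r p) := by
    rw [hW₁, weight_add _ _ _ _ _ hx0 hr0, Real.rpow_neg_one, Real.rpow_two]; ring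
  have e2 : W₂ = w * (x p ^ 2 / r p ^ 2) := by
    rw [hW₂, weight_add _ _ _ _ _ hx0 hr0, Real.rpow_neg hr0.le, Real.rpow_two, Real.rpow_two]; ring
  have key : ∀ k, pderiv k (carlemanField x r χ s σ μ S E k) p
      = S * W₁ * (((2 * σ + 2) / x p + s * r p / x p ^ 2) * pderiv k x p ^ 2
          + ((2 * μ + -1) / r p - s / x p) * (pderiv k r p * pderiv k x p)
          + pderiv k (pderiv k x) p)
        + E * W₂ * (pderiv k χ p * p k
          + χ p * (((2 * σ + 2) / x p + s * r p / x p ^ 2) * (pderiv k x p * p k)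
            + ((2 * μ + -2) / r p - s / x p) * (pderiv k r p * p k) + 1)) := by
    intro k
    have hc := differentiableAt_coord k p
    have h1 := (hw (2 * σ + 2) (2 * μ + -1)).fun_mul (hxk k)
    have h2 := hχ.fun_mul (hw (2 * σ + 2) (2 * μ + -2))
    unfold carlemanField
    rw [pderiv_add k ((differentiableAt_const _).fun_mul h1)
      ((differentiableAt_const _).fun_mul (h2.fun_mul hc)),
      pderiv_mul k (differentiableAt_const _) h1, pderiv_mul k (differentiableAt_const _)
      (h2.fun_mul hc), pderiv_mul k (hw _ _) (hxk k), pderiv_mul k h2 hc, pderiv_mul k hχ (hw _ _),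
      pderiv_coord, pderiv_const, pderiv_const, pderiv_weight _ _ _ hx hr hx0 hr0,
      pderiv_weight _ _ _ hx hr hx0 hr0]
    ring
  simp_rw [key, Finset.sum_add_distrib, ← Finset.mul_sum, Finset.sum_add_distrib,
    ← Finset.mul_sum, Finset.sum_add_distrib, ← Finset.mul_sum]
  simp only [Finset.sum_const, Finset.card_univ, Fintype.card_fin, nsmul_eq_mul, mul_one]
  generalize (∑ k, pderiv k x p ^ 2) = G at *
  generalize (∑ k, pderiv k r p * pderiv k x p) = H at *
  generalize (∑ k, pderiv k (pderiv k x) p) = L at *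
  generalize (∑ k, pderiv k χ p * p k) = τ at *
  generalize (∑ k, pderiv k x p * p k) = a at *
  generalize (∑ k, pderiv k r p * p k) = b at *
  -- Euler's relation for `x` and `r`, valid where `χ ≠ 0`: the two terms from the exponential
  -- cancel, the powers give `2σ + 2 + 2μ - 2`, and `n` is the divergence of the position field.
  have e3 : χ p * (((2 * σ + 2) / x p + s * r p / x p ^ 2) * a
      + ((2 * μ + -2) / r p - s / x p) * b + n)
      = χ p * (2 * (σ + μ + n / 2)) := by
    have : χ p * (((2 * σ + 2) / x p + s * r p / x p ^ 2) * a
      + ((2 * μ + -2) / r p - s / x p) * b + n)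
      = ((2 * σ + 2) / x p + s * r p / x p ^ 2) * (χ p * a)
        + ((2 * μ + -2) / r p - s / x p) * (χ p * b) + χ p * n := by ring
    rw [this, hxs, hrs]
    field_simp
    ring
  rw [e3, e1, e2]
  field_simp
  ring

end

variable {x r : Euc n → ℝ}

/-- A smooth radial function which vanishes in the ball of radius `ρ` and equals one away from the
ball of radius `ρ + 1`. -/
noncomputable def radialCutoff (ρ : ℝ) (p : Euc n) : ℝ := Real.smoothTransition (‖p‖ ^ 2 - ρ ^ 2)

theorem contDiff_radialCutoff (ρ : ℝ) : ContDiff ℝ 1 (radialCutoff (n := n) ρ) :=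
  (Real.smoothTransition.contDiff (n := 1)).comp ((contDiff_norm_sq ℝ).sub contDiff_const)

theorem radialCutoff_nonneg (ρ : ℝ) (p : Euc n) : 0 ≤ radialCutoff ρ p :=
  Real.smoothTransition.nonneg _

theorem radialCutoff_le_one (ρ : ℝ) (p : Euc n) : radialCutoff ρ p ≤ 1 :=
  Real.smoothTransition.le_one _

theorem radialCutoff_eq_zero {ρ : ℝ} {p : Euc n} (hp : ‖p‖ ≤ ρ) : radialCutoff ρ p = 0 :=
  Real.smoothTransition.zero_of_nonpos (by nlinarith [norm_nonneg p])

theorem eventually_radialCutoff_eq_one {ρ : ℝ} (hρ : 0 < ρ) {p : Euc n} (hp : ρ + 1 ≤ ‖p‖) :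
    radialCutoff ρ =ᶠ[𝓝 p] fun _ => 1 := by
  have h : ρ ^ 2 + 1 < ‖p‖ ^ 2 := by nlinarith
  have hc : Continuous fun q : Euc n => ‖q‖ ^ 2 := by fun_prop
  filter_upwards [hc.continuousAt.eventually (lt_mem_nhds h)] with q hq
  exact Real.smoothTransition.one_of_one_le (by linarith)

theorem exists_radial_derivative_bound (ρ R : ℝ) :
    ∃ T : ℝ, 0 < T ∧ ∀ p : Euc n, ‖p‖ ≤ R → |∑ k, pderiv k (radialCutoff ρ) p * p k| ≤ T := by
  have hc : Continuous fun p : Euc n => ∑ k, pderiv k (radialCutoff ρ) p * p k := by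
    refine continuous_finsetSum _ fun k _ => Continuous.mul ?_ (by fun_prop)
    exact ((contDiff_radialCutoff ρ).continuous_fderiv (by simp)).clm_apply continuous_const
  obtain ⟨T, hT⟩ := (isCompact_closedBall (0 : Euc n) R).exists_bound_of_continuousOn hc.continuousOn
  exact ⟨max T 1, by positivity, fun p hp => (hT p (by simpa using hp)).trans (le_max_left _ _)⟩

theorem exists_weight_bound (a b s : ℝ) {x₀ x₁ r₀ r₁ : ℝ} (hx₀ : 0 < x₀) (hr₀ : 0 < r₀) :
    ∃ C : ℝ, 0 < C ∧ ∀ x r : ℝ, x₀ ≤ x → x ≤ x₁ → r₀ ≤ r → r ≤ r₁ → weight a b s x r ≤ C := by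
  have hc : ContinuousOn (fun z : ℝ × ℝ => weight a b s z.1 z.2) (Icc x₀ x₁ ×ˢ Icc r₀ r₁) := by
    unfold weight
    refine ((continuousOn_fst.rpow_const fun z hz => Or.inl ?_).mul
      (continuousOn_snd.rpow_const fun z hz => Or.inl ?_)).mul
      ((continuousOn_const.mul continuousOn_snd).div continuousOn_fst fun z hz => ?_).rexp
    · exact (hx₀.trans_le hz.1.1).ne'
    · exact (hr₀.trans_le hz.2.1).ne'
    · exact (hx₀.trans_le hz.1.1).ne'
  obtain ⟨C, hC⟩ := (isCompact_Icc.prod isCompact_Icc).exists_bound_of_continuousOn hc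
  refine ⟨max C 1, by positivity, fun x r h1 h2 h3 h4 => ?_⟩
  exact (le_abs_self _).trans ((hC (x, r) ⟨⟨h1, h2⟩, h3, h4⟩).trans (le_max_left _ _))

/-- There is a radius beyond which the radius function agrees with the norm and both spheres
coincide. -/
theorem IsRadiusFunction.exists_forall_iff (hΩ : IsScaleInvariantDomain Ω R₀)
    (hr : IsRadiusFunction Ω R₀ r) : ∃ R₁ : ℝ, ∀ R : ℝ, R₁ < R → R₀ < R → ∀ p ∈ Ω,
      (r p = R ↔ ‖p‖ = R) ∧ (r p ≤ R ↔ ‖p‖ ≤ R) := by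
  obtain ⟨C, -, hC⟩ := exists_bound_of_locally_bounded (Ω := Ω) (f := r) (fun p hp =>
    locally_bounded_of_tendsto ((hr.isHomogeneousAtInfinity hΩ).exists_tendsto hΩ.isOpen hp).1) R₀
  refine ⟨C, fun R hCR hR p hp => ?_⟩
  rcases lt_or_ge ‖p‖ R₀ with h | h
  · have := hC p hp h.le
    exact ⟨⟨fun h' => by linarith, fun h' => by linarith⟩,
      ⟨fun _ => by linarith, fun _ => by linarith⟩⟩
  · rw [hr.eq_norm p ⟨hp, by simpa using h⟩]
    simp

/-- Both pieces have size `w x²/r`: in the radial one, `χ |pₖ| ≤ r` offsets the additional factor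
`1/r`. -/
theorem abs_carlemanField_le {χ : Euc n → ℝ} {p : Euc n} {s σ μ S E M A : ℝ} (hx0 : 0 < x p)
    (hr0 : 0 < r p) {k : Fin n} (hM : |pderiv k x p| ≤ M) (hS : |S| = 1) (hE : |E| = A)
    (hχ : |χ p * p k| ≤ r p) :
    |carlemanField x r χ s σ μ S E k p|
      ≤ (M + A) * (weight (2 * σ) (2 * μ) s (x p) (r p) * (x p ^ 2 / r p)) := by
  have hw := weight_pos (2 * σ) (2 * μ) s hx0 hr0
  have e1 : weight (2 * σ + 2) (2 * μ + -1) s (x p) (r p)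
      = weight (2 * σ) (2 * μ) s (x p) (r p) * (x p ^ 2 / r p) := by
    rw [weight_add _ _ _ _ _ hx0 hr0, Real.rpow_neg_one, Real.rpow_two]; ring
  have e2 : weight (2 * σ + 2) (2 * μ + -2) s (x p) (r p)
      = weight (2 * σ) (2 * μ) s (x p) (r p) * (x p ^ 2 / r p) * (r p)⁻¹ := by
    rw [weight_add _ _ _ _ _ hx0 hr0, Real.rpow_neg hr0.le, Real.rpow_two, Real.rpow_two]
    field_simp
  set w := weight (2 * σ) (2 * μ) s (x p) (r p) * (x p ^ 2 / r p) with hw'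
  have hw0 : 0 < w := by positivity
  have hA : 0 ≤ A := hE ▸ abs_nonneg E
  unfold carlemanField
  rw [e1, e2]
  refine (abs_add_le _ _).trans ?_
  have h1 : |S * (w * pderiv k x p)| ≤ w * M := by
    rw [abs_mul, hS, one_mul, abs_mul, abs_of_pos hw0]; gcongr
  have h2 : |E * (χ p * (w * (r p)⁻¹) * p k)| ≤ A * w := by
    have : E * (χ p * (w * (r p)⁻¹) * p k) = E * (w * (r p)⁻¹ * (χ p * p k)) := by ring
    rw [this, abs_mul, hE, abs_mul, abs_of_pos (by positivity : 0 < w * (r p)⁻¹)]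
    calc A * (w * (r p)⁻¹ * |χ p * p k|) ≤ A * (w * (r p)⁻¹ * r p) := by gcongr
      _ = A * w := by field_simp
  linarith

/-! ### Lower bounds for the divergence -/

/-- Here `t` is `x/r`, `G` is `|∇x|²` and `K` the strength of the radial term. Below the threshold
`d` the gradient term exceeds the error `N t` by `a c / 2`; above it `hK` makes `t (K t - N)` at
least `a c / 2`. -/
theorem outer_lower_bound {a c N K d G t : ℝ} (ha : 0 < a) (hc : 0 < c) (hN : 0 < N) (hG : 0 ≤ G)
    (ht : 0 < t) (hGc : t < c → c ≤ G) (hd : 0 < d) (hd1 : d ≤ c) (hd2 : N * d ≤ a * c / 2)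
    (hK : N + a * c / (2 * d) ≤ K * d) : a * c / 2 ≤ a * G - N * t + t ^ 2 * K := by
  have hK0 : 0 < K := by
    by_contra! h
    have : 0 < a * c / (2 * d) := by positivity
    nlinarith
  rcases lt_or_ge t d with h | h
  · have h1 := hGc (h.trans_le hd1)
    have h2 : a * c ≤ a * G := by gcongr
    have h3 : N * t ≤ N * d := by gcongr
    have h4 : 0 < t ^ 2 * K := by positivity
    linarith
  · have h1 : a * c / (2 * d) ≤ K * t - N := by
      have : K * d ≤ K * t := by gcongr
      linarith
    have h2 : a * c / 2 = d * (a * c / (2 * d)) := by field_simp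
    have h3 : d * (a * c / (2 * d)) ≤ t * (K * t - N) := by gcongr
    have h4 : 0 ≤ a * G := by positivity
    nlinarith

/-- Lower bound for the divergence of the vector field with respect to a density `D`. -/
theorem le_sum_pderiv_carlemanField_mul {χ D : Euc n → ℝ} {p : Euc n}
    {s σ μ S E M₁ M₂ M₃ M₄ N A e : ℝ} (hx : DifferentiableAt ℝ x p) (hr : DifferentiableAt ℝ r p)
    (hχ : DifferentiableAt ℝ χ p) (hxk : ∀ k, DifferentiableAt ℝ (pderiv k x) p) (hx0 : 0 < x p)
    (hr0 : 0 < r p) (hxs : χ p * ∑ k, pderiv k x p * p k = χ p * x p)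
    (hrs : χ p * ∑ k, pderiv k r p * p k = χ p * r p) (hM₂ : 0 ≤ M₂)
    (hxb : ∀ k, |pderiv k x p| ≤ M₁) (hrb : ∀ k, |pderiv k r p| ≤ M₂) (htb : x p / r p ≤ M₃)
    (hLb : |r p * ∑ k, pderiv k (pderiv k x) p| ≤ M₄)
    (hN : (|2 * σ + 2| * (n * M₁ ^ 2) + |s| * (n * (M₂ * M₁)))
      + M₃ * (|2 * μ - 1| * (n * (M₂ * M₁)) + M₄) ≤ N)
    (hS1 : |S| = 1) (hSs : S * s = |s|) (hE1 : |E| = A)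
    (hEβ : E * (σ + μ + n / 2) = A * |σ + μ + n / 2|) (hχr : ∀ k, |χ p * p k| ≤ r p)
    (hD : 0 < D p) (hep : ∀ k, |pderiv k D p| ≤ e * D p) :
    weight (2 * σ) (2 * μ) s (x p) (r p) * D p
        * (|s| * ∑ k, pderiv k x p ^ 2 - N * (x p / r p)
          + (x p / r p) ^ 2 * (2 * (|σ + μ + n / 2| * A) * χ p + E * ∑ k, pderiv k χ p * p k
            - n * (M₁ + A) * (r p * e)))
      ≤ ∑ k, (pderiv k (carlemanField x r χ s σ μ S E k) p * D p
        + carlemanField x r χ s σ μ S E k p * pderiv k D p) := by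
  have hw := weight_pos (2 * σ) (2 * μ) s hx0 hr0
  have hdiv := sum_pderiv_carlemanField hx hr hχ hxk hx0 hr0 hxs hrs s σ μ S E
  have hφ : ∀ k, |carlemanField x r χ s σ μ S E k p|
    ≤ (M₁ + A) * (weight (2 * σ) (2 * μ) s (x p) (r p) * (x p ^ 2 / r p)) := fun k =>
    abs_carlemanField_le hx0 hr0 (hxb k) hS1 hE1 (hχr k)
  have hA : 0 ≤ A := hE1 ▸ abs_nonneg E
  rw [Finset.sum_add_distrib, ← Finset.sum_mul, hdiv]
  -- The contribution of `∂D`, bounded by size only.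
  have herr : -(n * ((M₁ + A) * (weight (2 * σ) (2 * μ) s (x p) (r p) * (x p ^ 2 / r p))
      * (e * D p))) ≤ ∑ k, carlemanField x r χ s σ μ S E k p * pderiv k (D) p := by
    have h1 : ∀ k ∈ Finset.univ, -((M₁ + A) * (weight (2 * σ) (2 * μ) s (x p) (r p)
        * (x p ^ 2 / r p)) * (e * D p)) ≤ carlemanField x r χ s σ μ S E k p * pderiv k (D) p :=
      fun k _ => by
        refine neg_le_of_abs_le ?_
        rw [abs_mul]
        exact mul_le_mul (hφ k) (hep k) (abs_nonneg _)
          ((abs_nonneg _).trans (hφ k))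
    have h2 := Finset.sum_le_sum h1
    simpa [Finset.sum_neg_distrib] using h2
  refine le_trans ?_ (add_le_add_right herr _)
  have hG0 : |∑ k, pderiv k x p ^ 2| ≤ n * M₁ ^ 2 := by
    refine (Finset.abs_sum_le_sum_abs _ _).trans ?_
    have : ∀ k ∈ Finset.univ, |pderiv k x p ^ 2| ≤ M₁ ^ 2 := fun k _ => by
      rw [abs_pow]; exact pow_le_pow_left₀ (abs_nonneg _) (hxb k) 2
    simpa using Finset.sum_le_sum this
  have hH0 : |∑ k, pderiv k r p * pderiv k x p| ≤ n * (M₂ * M₁) := by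
    refine (Finset.abs_sum_le_sum_abs _ _).trans ?_
    have : ∀ k ∈ Finset.univ, |pderiv k r p * pderiv k x p| ≤ M₂ * M₁ := fun k _ => by
      rw [abs_mul]; exact mul_le_mul (hrb k) (hxb k) (abs_nonneg _) hM₂
    simpa using Finset.sum_le_sum this
  have hL0 := hLb
  have ht0 : 0 < x p / r p := div_pos hx0 hr0
  have htM := htb
  have hxt : x p ^ 2 / r p = (x p / r p) ^ 2 * r p := by field_simp
  rw [hxt]
  generalize (∑ k, pderiv k x p ^ 2) = G at *
  generalize (∑ k, pderiv k r p * pderiv k x p) = H at *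
  generalize r p * (∑ k, pderiv k (pderiv k x) p) = L at *
  generalize (∑ k, pderiv k χ p * p k) = τ at *
  generalize x p / r p = t at *
  generalize weight (2 * σ) (2 * μ) s (x p) (r p) = w at *
  generalize hDp : D p = d at *
  -- All terms of the gradient piece without a sign; the quadratic ones are made linear in `t` by `t
  -- ≤ M₃`.
  have hlow : |S * (t * ((2 * σ + 2) * G - s * H) + t ^ 2 * ((2 * μ - 1) * H + L))| ≤ N * t := by
    rw [abs_mul, hS1, one_mul]
    have h1 : |(2 * σ + 2) * G - s * H| ≤ |2 * σ + 2| * (n * M₁ ^ 2) + |s| * (n * (M₂ * M₁)) := by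
      refine (abs_sub _ _).trans ?_
      rw [abs_mul, abs_mul]; gcongr
    have h2 : |(2 * μ - 1) * H + L| ≤ |2 * μ - 1| * (n * (M₂ * M₁)) + M₄ := by
      refine (abs_add_le _ _).trans ?_
      rw [abs_mul]; gcongr
    have h3 : t ^ 2 ≤ t * M₃ := by nlinarith
    have h4 : 0 ≤ t * M₃ := mul_nonneg ht0.le (ht0.le.trans htM)
    calc |t * ((2 * σ + 2) * G - s * H) + t ^ 2 * ((2 * μ - 1) * H + L)|
        ≤ t * |(2 * σ + 2) * G - s * H| + t ^ 2 * |(2 * μ - 1) * H + L| := by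
          refine (abs_add_le _ _).trans ?_
          rw [abs_mul, abs_mul, abs_of_pos ht0, abs_of_pos (by positivity : 0 < t ^ 2)]
      _ ≤ t * (|2 * σ + 2| * (n * M₁ ^ 2) + |s| * (n * (M₂ * M₁)))
          + t * M₃ * (|2 * μ - 1| * (n * (M₂ * M₁)) + M₄) := by gcongr
      _ = (|2 * σ + 2| * (n * M₁ ^ 2) + |s| * (n * (M₂ * M₁))
          + M₃ * (|2 * μ - 1| * (n * (M₂ * M₁)) + M₄)) * t := by ring
      _ ≤ N * t := by gcongr
  have hlow' := neg_le_of_abs_le hlow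
  have hfin : S * (s * G + t * ((2 * σ + 2) * G - s * H) + t ^ 2 * ((2 * μ - 1) * H + L))
        + E * (t ^ 2 * (χ p * (2 * (σ + μ + n / 2)) + τ))
      = |s| * G + S * (t * ((2 * σ + 2) * G - s * H) + t ^ 2 * ((2 * μ - 1) * H + L))
        + t ^ 2 * (2 * (|σ + μ + n / 2| * A) * χ p + E * τ) := by
    rw [← hSs]
    linear_combination (2 * t ^ 2 * χ p) * hEβ
  rw [hfin]
  have hwD : 0 < w * d := mul_pos hw hD
  have := mul_le_mul_of_nonneg_left hlow' hwD.le
  linarith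

set_option maxHeartbeats 800000 in
/-- The main terms of the divergence of the vector field dominate all the other ones. -/
theorem exists_carlemanField (hΩ : IsScaleInvariantDomain Ω R₀)
    (hx : IsScalingDefiningFunction Ω R₀ x) (hr : IsRadiusFunction Ω R₀ r)
    (hg : IsAsymptoticallyEuclideanMetric Ω g) {s σ μ : ℝ} (hs : s ≠ 0)
    (hβ : σ + μ + (n : ℝ) / 2 ≠ 0) :
    ∃ x₀ c C R : ℝ, 0 < x₀ ∧ 0 < c ∧ 0 < C ∧ R₀ < R ∧ (∀ p ∈ Ω, r p = R ↔ ‖p‖ = R) ∧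
      ∃ φ : Fin n → Euc n → ℝ, (∀ k, ∀ p ∈ Ω, ContDiffAt ℝ 1 (φ k) p) ∧
        (∀ k, ∀ p ∈ Ω, |φ k p| ≤ C * (weight (2 * σ) (2 * μ) s (x p) (r p) * (x p ^ 2 / r p))) ∧
        (∀ᵐ p : Euc n, p ∈ Ω → (x p < x₀ ∨ R < r p) →
          c * (weight (2 * σ) (2 * μ) s (x p) (r p) * volDensity g p)
          ≤ ∑ k, (pderiv k (φ k) p * volDensity g p + φ k p * pderiv k (volDensity g) p)) ∧
        (∀ᵐ p : Euc n, p ∈ Ω → x₀ ≤ x p → r p ≤ R →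
          c * (weight (2 * σ) (2 * μ) s (x p) (r p) * volDensity g p)
          ≤ ∑ k, (pderiv k (φ k) p * volDensity g p + φ k p * pderiv k (volDensity g) p)
            + C * volDensity g p) := by
  have hxh := hx.isHomogeneousAtInfinity hΩ
  have hrh := hr.isHomogeneousAtInfinity hΩ
  have hR₀ := hΩ.one_le
  obtain ⟨M₁, hM₁, hxb⟩ := hxh.exists_pderiv_bound hΩ
  obtain ⟨M₂, hM₂, hrb⟩ := hrh.exists_pderiv_bound hΩ
  obtain ⟨M₃, hM₃, htb⟩ := exists_ratio_bound hΩ hx hr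
  obtain ⟨M₄, hM₄, hLb⟩ := exists_laplacian_bound hΩ hx hr
  obtain ⟨c₀, hc₀, hGb⟩ := exists_gradient_lower_bound hΩ hx hr
  obtain ⟨R₁, hR₁⟩ := hr.exists_forall_iff hΩ
  obtain ⟨r₀, hr₀, hrr₀⟩ := hr.bddBelow
  set β := σ + μ + (n : ℝ) / 2 with hβdef
  have hs' : 0 < |s| := abs_pos.2 hs
  have hβ' : 0 < |β| := abs_pos.2 hβ
  -- bound for the lower order terms
  obtain ⟨N, N_def⟩ : ∃ y : ℝ, y = (|2 * σ + 2| * (n * M₁ ^ 2) + |s| * (n * (M₂ * M₁)))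
    + M₃ * (|2 * μ - 1| * (n * (M₂ * M₁)) + M₄) + 1 := ⟨_, rfl⟩
  have hN : 0 < N := by rw [N_def]; positivity
  -- The threshold for `x/r` below which the gradient term alone beats the error `N t` by a factor
  -- of two.
  obtain ⟨d, d_def⟩ : ∃ y : ℝ, y = min c₀ (|s| * c₀ / (2 * N)) := ⟨_, rfl⟩
  have hd : 0 < d := by rw [d_def]; positivity
  have hd2 : N * d ≤ |s| * c₀ / 2 := by
    calc N * d ≤ N * (|s| * c₀ / (2 * N)) := by gcongr; rw [d_def]; exact min_le_right _ _
      _ = _ := by field_simp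
  -- Solves the condition of `outer_lower_bound` with equality, for `K = |β| A`.
  obtain ⟨A, A_def⟩ : ∃ y : ℝ, y = (N + |s| * c₀ / (2 * d)) / d / |β| := ⟨_, rfl⟩
  have hA : 0 < A := by rw [A_def]; positivity
  have hKA : N + |s| * c₀ / (2 * d) ≤ |β| * A * d := by
    apply le_of_eq; rw [A_def]; field_simp
  -- The density error may consume one of the two copies of `|β| A` in the radial term. The order of
  -- choice `A`, `η`, `R`, `δ` avoids circularity: the bounds on `r ≤ R` affect only `δ` and later
  -- constants.
  obtain ⟨η, η_def⟩ : ∃ y : ℝ, y = |β| * A / ((n + 1) * (M₁ + A)) := ⟨_, rfl⟩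
  have hη : 0 < η := by rw [η_def]; positivity
  have hηA : n * (M₁ + A) * η ≤ |β| * A := by
    have : n * (M₁ + A) * η = |β| * A * (n / (n + 1)) := by rw [η_def]; field_simp
    rw [this]
    refine mul_le_of_le_one_right (by positivity) ((div_le_one (by positivity)).2 (by linarith))
  obtain ⟨ρ, hρ⟩ := hg.exists_pderiv_volDensity_bound_outer hΩ.isOpen hη
  -- `R₀ + 2` ensures that the cutoff, which starts at `R₀ + 1`, is locally one where `r > R`.
  obtain ⟨R, R_def⟩ : ∃ y : ℝ, y = max (R₀ + 2) (max ρ (R₁ + 1)) := ⟨_, rfl⟩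
  have hRR₀ : R₀ + 2 ≤ R := R_def ▸ le_max_left _ _
  have hRρ : ρ ≤ R := R_def ▸ (le_max_left _ _).trans (le_max_right _ _)
  have hRR₁ : R₁ + 1 ≤ R := R_def ▸ (le_max_right _ _).trans (le_max_right _ _)
  have hR := hR₁ R (by linarith) (by linarith)
  have hR0 : 0 < R := by linarith
  obtain ⟨Cin, hCin, hin⟩ := hg.exists_pderiv_volDensity_bound_inner hΩ.isOpen R
  obtain ⟨T, hT, hTb⟩ := exists_radial_derivative_bound (n := n) (R₀ + 1) R
  -- On `r ≤ R` the coefficient of `(x/r)²` has no sign; `-N₂` bounds it from below.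
  obtain ⟨N₂, N₂_def⟩ : ∃ y : ℝ, y = 2 * |β| * A + A * T + n * (M₁ + A) * (R * Cin) := ⟨_, rfl⟩
  have hN₂ : 0 < N₂ := by rw [N₂_def]; positivity
  obtain ⟨δ, δ_def⟩ : ∃ y : ℝ, y = min c₀ (|s| * c₀ / (2 * (N + N₂ * M₃))) := ⟨_, rfl⟩
  have hδ : 0 < δ := by rw [δ_def]; positivity
  have hδ2 : (N + N₂ * M₃) * δ ≤ |s| * c₀ / 2 := by
    calc (N + N₂ * M₃) * δ ≤ (N + N₂ * M₃) * (|s| * c₀ / (2 * (N + N₂ * M₃))) := by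
          gcongr; rw [δ_def]; exact min_le_right _ _
      _ = _ := by field_simp
  -- As `r ≥ r₀`, the condition `x < x₀` forces `x/r < δ`.
  obtain ⟨x₀, x₀_def⟩ : ∃ y : ℝ, y = δ * r₀ := ⟨_, rfl⟩
  have hx₀ : 0 < x₀ := by rw [x₀_def]; positivity
  obtain ⟨Wm, hWm, hWb⟩ := exists_weight_bound (2 * σ) (2 * μ) s (x₁ := M₃ * R) (r₁ := R) hx₀ hr₀
  obtain ⟨c, c_def⟩ : ∃ y : ℝ, y = |s| * c₀ / 2 := ⟨_, rfl⟩
  have hc : 0 < c := by rw [c_def]; positivity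
  obtain ⟨N₃, N₃_def⟩ : ∃ y : ℝ, y = N * M₃ + N₂ * M₃ ^ 2 := ⟨_, rfl⟩
  have hN₃ : 0 < N₃ := by rw [N₃_def]; positivity
  -- One constant for two purposes: `M₁ + A` bounds the field, and `(c + N₃) Wm` bounds the deficit
  -- on `x ≥ x₀`, `r ≤ R`.
  obtain ⟨C, C_def⟩ : ∃ y : ℝ, y = (M₁ + A) + (c + N₃) * Wm := ⟨_, rfl⟩
  have hC : 0 < C := by rw [C_def]; positivity
  -- `S` is the sign of `s`, and `E` below is `A` times the sign of `β`, so that both main terms are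
  -- nonnegative.
  obtain ⟨S, S_def⟩ : ∃ y : ℝ, y = s / |s| := ⟨_, rfl⟩
  have hS1 : |S| = 1 := by rw [S_def]; rw [abs_div, abs_abs, div_self hs'.ne']
  have hSs : S * s = |s| := by
    rw [S_def]; rw [div_mul_eq_mul_div, ← abs_mul_abs_self, mul_div_assoc, div_self hs'.ne', mul_one]
  obtain ⟨E, E_def⟩ : ∃ y : ℝ, y = A * (β / |β|) := ⟨_, rfl⟩
  have hE1 : |E| = A := by
    rw [E_def, abs_mul, abs_div, abs_abs, div_self hβ'.ne', mul_one, abs_of_pos hA]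
  have hEβ : E * β = A * |β| := by
    rw [E_def, mul_assoc, div_mul_eq_mul_div, ← abs_mul_abs_self, mul_div_assoc, div_self hβ'.ne', mul_one]
  let χ : Euc n → ℝ := radialCutoff (R₀ + 1)
  have hχ0 : ∀ p, 0 ≤ χ p := radialCutoff_nonneg _
  have hχ1 : ∀ p, χ p ≤ 1 := radialCutoff_le_one _
  let φ := carlemanField x r χ s σ μ S E
  have hχr : ∀ p ∈ Ω, ∀ k, |χ p * p k| ≤ r p := fun p hp k => by
    rcases le_total ‖p‖ (R₀ + 1) with h | h
    · simp only [χ, radialCutoff_eq_zero h, zero_mul, abs_zero]; exact (hr.pos hp).le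
    · rw [hr.eq_norm p ⟨hp, by simpa using (by linarith : R₀ ≤ ‖p‖)⟩, abs_mul, abs_of_nonneg (hχ0 p)]
      exact (mul_le_of_le_one_left (abs_nonneg _) (hχ1 p)).trans (PiLp.norm_apply_le p k)
  have hφ : ∀ k, ∀ p ∈ Ω, |φ k p|
      ≤ (M₁ + A) * (weight (2 * σ) (2 * μ) s (x p) (r p) * (x p ^ 2 / r p)) := fun k p hp =>
    abs_carlemanField_le (hx.pos p hp) (hr.pos hp) (hxb p hp k) hS1 hE1 (hχr p hp k)
  have hEul : ∀ h : Euc n → ℝ, IsHomogeneousAtInfinity Ω R₀ h → ∀ p ∈ Ω,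
      χ p * ∑ k, pderiv k h p * p k = χ p * h p := fun h hh p hp => by
    rcases le_total ‖p‖ (R₀ + 1) with h' | h'
    · simp only [χ, radialCutoff_eq_zero h', zero_mul]
    · rw [hh.sum_pderiv_mul hΩ.isOpen hp (by linarith)]
  have main : ∀ p ∈ Ω, ∀ e : ℝ, (∀ k, |pderiv k (volDensity g) p| ≤ e * volDensity g p) →
      weight (2 * σ) (2 * μ) s (x p) (r p) * volDensity g p
        * (|s| * ∑ k, pderiv k x p ^ 2 - N * (x p / r p)
          + (x p / r p) ^ 2 * (2 * (|β| * A) * χ p + E * ∑ k, pderiv k χ p * p k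
            - n * (M₁ + A) * (r p * e)))
      ≤ ∑ k, (pderiv k (φ k) p * volDensity g p + φ k p * pderiv k (volDensity g) p) :=
    fun p hp e hep => le_sum_pderiv_carlemanField_mul
      ((hxh.contDiffAt hΩ.isOpen hp).differentiableAt (by simp))
      ((hrh.contDiffAt hΩ.isOpen hp).differentiableAt (by simp))
      ((contDiff_radialCutoff (R₀ + 1)).contDiffAt.differentiableAt (by simp))
      (fun k => (hxh.contDiffAt_pderiv hΩ.isOpen hp k).differentiableAt (by simp)) (hx.pos p hp)
      (hr.pos hp) (hEul x hxh p hp) (hEul r hrh p hp) hM₂.le (hxb p hp) (hrb p hp)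
      (htb p hp) (hLb p hp) (N_def ▸ (lt_add_one _).le) hS1 hSs hE1 hEβ (hχr p hp)
      (hg.volDensity_pos hp) hep
  have hGc : ∀ p ∈ Ω, 0 ≤ ∑ k, pderiv k x p ^ 2 := fun p _ =>
    Finset.sum_nonneg fun _ _ => sq_nonneg _
  -- lower bound in the bounded part of the domain
  have inner : ∀ᵐ p : Euc n, p ∈ Ω → r p ≤ R →
      weight (2 * σ) (2 * μ) s (x p) (r p) * volDensity g p
        * (|s| * ∑ k, pderiv k x p ^ 2 - N * (x p / r p) - (x p / r p) ^ 2 * N₂)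
      ≤ ∑ k, (pderiv k (φ k) p * volDensity g p + φ k p * pderiv k (volDensity g) p) := by
    filter_upwards [hin] with p hpin hp hpR
    refine le_trans ?_ (main p hp Cin (hpin hp ((hR p hp).2.1 hpR)))
    have hD := hg.volDensity_pos hp
    have hw := weight_pos (2 * σ) (2 * μ) s (hx.pos p hp) (hr.pos hp)
    have h1 : -(A * T) ≤ E * ∑ k, pderiv k χ p * p k := by
      refine neg_le_of_abs_le ?_
      rw [abs_mul, hE1]
      exact mul_le_mul_of_nonneg_left (hTb p ((hR p hp).2.1 hpR)) hA.le
    have h2 : n * (M₁ + A) * (r p * Cin) ≤ n * (M₁ + A) * (R * Cin) := by gcongr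
    have h3 : 0 ≤ 2 * (|β| * A) * χ p := mul_nonneg (by positivity) (hχ0 p)
    have h4 : -N₂ ≤ 2 * (|β| * A) * χ p + E * ∑ k, pderiv k χ p * p k
            - n * (M₁ + A) * (r p * Cin) := by
      have : 0 < 2 * |β| * A := by positivity
      rw [N₂_def]; linarith
    have h5 := mul_le_mul_of_nonneg_left h4 (sq_nonneg (x p / r p))
    refine mul_le_mul_of_nonneg_left ?_ (by positivity)
    linarith
  refine ⟨x₀, c, C, R, hx₀, hc, hC, by linarith, fun p hp => (hR p hp).1, φ, fun k p hp =>
    contDiffAt_carlemanField (hxh.contDiffAt hΩ.isOpen hp) (hrh.contDiffAt hΩ.isOpen hp)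
      (contDiff_radialCutoff _).contDiffAt (hxh.contDiffAt_pderiv hΩ.isOpen hp) (hx.pos p hp)
      (hr.pos hp) s σ μ S E k, fun k p hp => ?_, ?_, ?_⟩
  · refine (hφ k p hp).trans ?_
    have := weight_pos (2 * σ) (2 * μ) s (hx.pos p hp) (hr.pos hp)
    have := hr.pos hp
    gcongr
    rw [C_def]
    have : 0 < (c + N₃) * Wm := by positivity
    linarith
  · filter_upwards [inner, hρ] with p hpin hpout hp hgood
    have hx0 := hx.pos p hp
    have hr0 := hr.pos hp
    have hD := hg.volDensity_pos hp
    have hw := weight_pos (2 * σ) (2 * μ) s hx0 hr0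
    have ht0 : 0 < x p / r p := div_pos hx0 hr0
    rcases le_or_gt (r p) R with hpR | hpR
    · have hxx₀ : x p < x₀ := hgood.resolve_right (not_lt.2 hpR)
      have htδ : x p / r p < δ := by
        rw [div_lt_iff₀ hr0]
        rw [x₀_def] at hxx₀
        exact hxx₀.trans_le (mul_le_mul_of_nonneg_left (hrr₀ p hp) hδ.le)
      refine le_trans ?_ (hpin hp hpR)
      have hG := hGb p hp (htδ.trans_le (δ_def ▸ min_le_left _ _))
      have h1 : |s| * c₀ ≤ |s| * ∑ k, pderiv k x p ^ 2 := by gcongr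
      have h2 : N * (x p / r p) + (x p / r p) ^ 2 * N₂ ≤ |s| * c₀ / 2 := by
        have h3 : (x p / r p) ^ 2 * N₂ ≤ N₂ * M₃ * (x p / r p) := by
          rw [sq]
          have := htb p hp
          calc x p / r p * (x p / r p) * N₂ ≤ x p / r p * M₃ * N₂ := by gcongr
            _ = _ := by ring
        have h4 : (N + N₂ * M₃) * (x p / r p) ≤ (N + N₂ * M₃) * δ := by gcongr
        linarith
      rw [mul_comm c]
      refine mul_le_mul_of_nonneg_left ?_ (by positivity)
      rw [c_def]; linarith
    · have hpn : R < ‖p‖ := by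
        by_contra! h
        exact absurd ((hR p hp).2.2 h) (not_le.2 hpR)
      have hpe : r p = ‖p‖ := hr.eq_norm p ⟨hp, by simpa using (by linarith : R₀ ≤ ‖p‖)⟩
      have hp0 : 0 < ‖p‖ := by linarith
      refine le_trans ?_ (main p hp (η / ‖p‖) (hpout hp (by linarith)))
      have hχe : χ =ᶠ[𝓝 p] fun _ => 1 := eventually_radialCutoff_eq_one (by linarith) (by linarith)
      have hχp : χ p = 1 := hχe.self_of_nhds
      simp_rw [hχe.pderiv_eq, pderiv_const, hχp, hpe]
      have h1 : ‖p‖ * (η / ‖p‖) = η := by field_simp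
      rw [h1, hpe.symm]
      have h2 := outer_lower_bound (G := ∑ k, pderiv k x p ^ 2) hs' hc₀ hN (hGc p hp) ht0
        (hGb p hp) hd (d_def ▸ min_le_left _ _) hd2 hKA
      have h3 : (x p / r p) ^ 2 * (|β| * A) ≤ (x p / r p) ^ 2 * (2 * (|β| * A) * 1
          + E * ∑ k : Fin n, 0 * p k - n * (M₁ + A) * η) := by
        refine mul_le_mul_of_nonneg_left ?_ (sq_nonneg _)
        simp only [zero_mul, Finset.sum_const_zero, mul_zero]
        linarith
      rw [mul_comm c]
      refine mul_le_mul_of_nonneg_left ?_ (by positivity)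
      rw [c_def]; linarith
  · filter_upwards [inner] with p hpin hp hpx hpR
    have hx0 := hx.pos p hp
    have hr0 := hr.pos hp
    have hD := hg.volDensity_pos hp
    have hw := weight_pos (2 * σ) (2 * μ) s hx0 hr0
    have ht0 : 0 < x p / r p := div_pos hx0 hr0
    have htM := htb p hp
    have h1 := hpin hp hpR
    have h2 : -N₃ ≤ |s| * ∑ k, pderiv k x p ^ 2 - N * (x p / r p) - (x p / r p) ^ 2 * N₂ := by
      have h3 : 0 ≤ |s| * ∑ k, pderiv k x p ^ 2 := mul_nonneg hs'.le (hGc p hp)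
      have h4 : N * (x p / r p) ≤ N * M₃ := by gcongr
      have h5 : (x p / r p) ^ 2 * N₂ ≤ M₃ ^ 2 * N₂ := by gcongr
      rw [N₃_def]; linarith
    have hwW : weight (2 * σ) (2 * μ) s (x p) (r p) ≤ Wm := by
      refine hWb _ _ hpx ?_ (hrr₀ p hp) hpR
      rw [div_le_iff₀ hr0] at htM
      exact htM.trans (by gcongr)
    have h6 := mul_le_mul_of_nonneg_left h2 (mul_pos hw hD).le
    have h7 : (c + N₃) * (weight (2 * σ) (2 * μ) s (x p) (r p) * volDensity g p)
        ≤ C * volDensity g p := by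
      rw [← mul_assoc]
      refine mul_le_mul_of_nonneg_right ?_ hD.le
      calc (c + N₃) * weight (2 * σ) (2 * μ) s (x p) (r p) ≤ (c + N₃) * Wm := by gcongr
        _ ≤ C := by rw [C_def]; linarith
    linarith

/-! ### Bounded measurable functions on a compact set -/

/-- The function `f` is measurable and bounded on `K`. -/
def BddMeasOn (K : Set (Euc n)) (f : Euc n → ℝ) : Prop :=
  AEStronglyMeasurable f (volume.restrict K) ∧ ∃ C : ℝ, ∀ p ∈ K, |f p| ≤ C

namespace BddMeasOn

variable {K : Set (Euc n)} {f h : Euc n → ℝ}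

theorem const (c : ℝ) : BddMeasOn K fun _ => c :=
  ⟨aestronglyMeasurable_const, |c|, fun _ _ => le_rfl⟩

theorem add (hf : BddMeasOn K f) (hh : BddMeasOn K h) : BddMeasOn K fun p => f p + h p := by
  obtain ⟨hf, C, hC⟩ := hf
  obtain ⟨hh, C', hC'⟩ := hh
  exact ⟨hf.add hh, C + C', fun p hp => (abs_add_le _ _).trans (add_le_add (hC p hp) (hC' p hp))⟩

theorem mul (hf : BddMeasOn K f) (hh : BddMeasOn K h) : BddMeasOn K fun p => f p * h p := by
  obtain ⟨hf, C, hC⟩ := hf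
  obtain ⟨hh, C', hC'⟩ := hh
  refine ⟨hf.mul hh, C * C', fun p hp => ?_⟩
  rw [abs_mul]
  exact mul_le_mul (hC p hp) (hC' p hp) (abs_nonneg _) ((abs_nonneg _).trans (hC p hp))

theorem neg (hf : BddMeasOn K f) : BddMeasOn K fun p => - f p := by
  simpa using (const (-1)).mul hf

theorem sub (hf : BddMeasOn K f) (hh : BddMeasOn K h) : BddMeasOn K fun p => f p - h p := by
  simpa [sub_eq_add_neg] using hf.add hh.neg

theorem sum {ι : Type*} (s : Finset ι) {f : ι → Euc n → ℝ} (hf : ∀ i, BddMeasOn K (f i)) :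
    BddMeasOn K fun p => ∑ i ∈ s, f i p := by
  classical
  induction s using Finset.induction_on with
  | empty => simpa using const 0
  | insert a s ha ih => simpa [Finset.sum_insert ha] using (hf a).add ih

theorem prod {ι : Type*} (s : Finset ι) {f : ι → Euc n → ℝ} (hf : ∀ i, BddMeasOn K (f i)) :
    BddMeasOn K fun p => ∏ i ∈ s, f i p := by
  classical
  induction s using Finset.induction_on with
  | empty => simpa using const 1
  | insert a s ha ih => simpa [Finset.prod_insert ha] using (hf a).mul ih

theorem of_continuousOn (hK : IsCompact K) (hf : ContinuousOn f K) : BddMeasOn K f :=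
  ⟨hf.aestronglyMeasurable hK.measurableSet, hK.exists_bound_of_continuousOn hf⟩

theorem integrable (hK : IsCompact K) (hf : BddMeasOn K f) (h0 : ∀ p ∉ K, f p = 0) :
    Integrable f := by
  obtain ⟨hf, C, hC⟩ := hf
  have : IntegrableOn f K := by
    refine IntegrableOn.of_bound hK.measure_lt_top hf C ?_
    filter_upwards [ae_restrict_mem hK.measurableSet] with p hp using hC p hp
  exact this.integrable_of_forall_notMem_eq_zero h0

end BddMeasOn

namespace IsAsymptoticallyEuclideanMetric

variable {K : Set (Euc n)}

theorem bddMeasOn_slotMetric (hg : IsAsymptoticallyEuclideanMetric Ω g) (hK : IsCompact K)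
    (hKΩ : K ⊆ Ω) (v : Variance) (i j : Fin n) :
    BddMeasOn K fun p => slotMetric v (g p) i j :=
  BddMeasOn.of_continuousOn hK fun p hp =>
    (contDiffAt_slotMetric (N := 0) (hg.posDef p (subset_closure (hKΩ hp))).det_pos.ne' v i j)
      |>.continuousAt.comp_continuousWithinAt
        ((hg.continuousOn p (subset_closure (hKΩ hp))).mono (hKΩ.trans subset_closure))

theorem bddMeasOn_tensorInner (hg : IsAsymptoticallyEuclideanMetric Ω g) (hK : IsCompact K)
    (hKΩ : K ⊆ Ω) (ε : Fin m → Variance) {S T : Euc n → Tensor n m}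
    (hS : ∀ I, BddMeasOn K fun p => S p I) (hT : ∀ I, BddMeasOn K fun p => T p I) :
    BddMeasOn K fun p => tensorInner ε (g p) (S p) (T p) :=
  BddMeasOn.sum _ fun I => BddMeasOn.sum _ fun J =>
    ((BddMeasOn.prod _ fun _ => hg.bddMeasOn_slotMetric hK hKΩ _ _ _).mul (hS I)).mul (hT J)

theorem bddMeasOn_pderiv (hg : IsAsymptoticallyEuclideanMetric Ω g) (hΩ : IsOpen Ω)
    (hK : IsCompact K) (hKΩ : K ⊆ Ω) (i j k : Fin n) :
    BddMeasOn K fun p => pderiv k (fun q => g q i j) p := by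
  obtain ⟨ρ, hρ⟩ := hK.isBounded.subset_closedBall 0
  obtain ⟨C, -, hC⟩ := exists_bound_of_locally_bounded
    (locally_bounded_pderiv hΩ (hg.locLipschitz i j) k) ρ
  exact ⟨(measurable_pderiv k _).aestronglyMeasurable, C,
    fun p hp => hC p (hKΩ hp) (by simpa using hρ hp)⟩

theorem bddMeasOn_connectionForm (hg : IsAsymptoticallyEuclideanMetric Ω g) (hΩ : IsOpen Ω)
    (hK : IsCompact K) (hKΩ : K ⊆ Ω) (v : Variance) (k i l : Fin n) :
    BddMeasOn K fun p => connectionForm v g p k i l := by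
  have h1 : ∀ k i j, BddMeasOn K fun p => christoffel g p k i j := fun k i j =>
    (BddMeasOn.const (1 / 2)).mul (BddMeasOn.sum _ fun l =>
      (hg.bddMeasOn_slotMetric hK hKΩ .covariant k l).mul
        (((hg.bddMeasOn_pderiv hΩ hK hKΩ j l i).add (hg.bddMeasOn_pderiv hΩ hK hKΩ i l j)).sub
          (hg.bddMeasOn_pderiv hΩ hK hKΩ i j l)))
  cases v
  · exact (h1 l k i).neg
  · exact h1 i k l

theorem bddMeasOn_covDeriv (hg : IsAsymptoticallyEuclideanMetric Ω g) (hΩ : IsOpen Ω)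
    (hK : IsCompact K) (hKΩ : K ⊆ Ω) (ε : Fin m → Variance) {u : Euc n → Tensor n m}
    (hu : ContDiff ℝ 2 u) (k : Fin n) (I : Fin m → Fin n) :
    BddMeasOn K fun p => covDeriv ε g u p k I := by
  have huI : ∀ I, ContDiff ℝ 2 fun p => u p I := fun I => contDiff_pi.1 hu I
  simp_rw [covDeriv_eq]
  refine (BddMeasOn.of_continuousOn hK ?_).add (BddMeasOn.sum _ fun a => BddMeasOn.sum _ fun l =>
    (hg.bddMeasOn_connectionForm hΩ hK hKΩ _ _ _ _).mul
      (BddMeasOn.of_continuousOn hK (huI _).continuous.continuousOn))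
  exact (((huI I).continuous_fderiv (by simp)).clm_apply continuous_const).continuousOn

theorem bddMeasOn_gradNormSq (hg : IsAsymptoticallyEuclideanMetric Ω g) (hΩ : IsOpen Ω)
    (hK : IsCompact K) (hKΩ : K ⊆ Ω) (ε : Fin m → Variance) {u : Euc n → Tensor n m}
    (hu : ContDiff ℝ 2 u) : BddMeasOn K (gradNormSq ε g u) :=
  BddMeasOn.sum _ fun k => BddMeasOn.sum _ fun l =>
    (hg.bddMeasOn_slotMetric hK hKΩ .covariant k l).mul
      (hg.bddMeasOn_tensorInner hK hKΩ ε (hg.bddMeasOn_covDeriv hΩ hK hKΩ ε hu k)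
        (hg.bddMeasOn_covDeriv hΩ hK hKΩ ε hu l))

end IsAsymptoticallyEuclideanMetric

/-! ### The energy density -/

theorem contDiffAt_tensorInner {N : WithTop ℕ∞} (ε : Fin m → Variance)
    {z : Matrix (Fin n) (Fin n) ℝ × Tensor n m} (hz : z.1.det ≠ 0) :
    ContDiffAt ℝ N (fun z : Matrix (Fin n) (Fin n) ℝ × Tensor n m =>
      tensorInner ε z.1 z.2 z.2) z := by
  have hT : ∀ I, ContDiffAt ℝ N (fun z : Matrix (Fin n) (Fin n) ℝ × Tensor n m => z.2 I) z :=
    fun I => (contDiff_pi.1 contDiff_snd I).contDiffAt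
  refine ContDiffAt.sum fun I _ => ContDiffAt.sum fun J _ => ((contDiffAt_prod fun a _ => ?_).mul
    (hT I)).mul (hT J)
  exact (contDiffAt_slotMetric hz (ε a) (I a) (J a)).comp z contDiffAt_fst

theorem differentiableAt_normSq {p : Euc n} (hg : ∀ i j, DifferentiableAt ℝ (fun q => g q i j) p)
    (hp : (g p).det ≠ 0) (ε : Fin m → Variance) {u : Euc n → Tensor n m}
    (hu : DifferentiableAt ℝ u p) : DifferentiableAt ℝ (normSq ε g u) p :=
  DifferentiableAt.comp (f := fun q => (g q, u q))
    (g := fun z : Matrix (Fin n) (Fin n) ℝ × Tensor n m => tensorInner ε z.1 z.2 z.2) p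
    ((contDiffAt_tensorInner (N := 1) ε hp).differentiableAt (by simp))
    ((differentiableAt_matrix hg).prodMk hu)

theorem differentiableAt_volDensity {p : Euc n}
    (hg : ∀ i j, DifferentiableAt ℝ (fun q => g q i j) p) (hp : 0 < (g p).det) :
    DifferentiableAt ℝ (volDensity g) p :=
  ((IsAsymptoticallyEuclideanMetric.contDiffAt_sqrt_det (N := 1) hp).differentiableAt
    (by simp)).comp p (differentiableAt_matrix hg)

theorem IsAsymptoticallyEuclideanMetric.locallyLipschitzOn_normSq_mul
    (hg : IsAsymptoticallyEuclideanMetric Ω g) (ε : Fin m → Variance) {u : Euc n → Tensor n m}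
    (hu : ContDiff ℝ 2 u) : LocallyLipschitzOn Ω fun p => normSq ε g u p * volDensity g p := by
  have h1 : LocallyLipschitzOn Ω u := locallyLipschitzOn_of_contDiffAt fun p _ =>
    (hu.of_le one_le_two).contDiffAt
  exact ((hg.locallyLipschitzOn.prodMk_on h1).contDiffAt_comp fun p hp =>
    contDiffAt_tensorInner ε (hg.posDef p (subset_closure hp)).det_pos.ne').real_mul
    (hg.locallyLipschitzOn.contDiffAt_comp fun p hp =>
      contDiffAt_sqrt_det (hg.posDef p (subset_closure hp)).det_pos)

theorem normSq_eq_zero (ε : Fin m → Variance) {u : Euc n → Tensor n m} {p : Euc n}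
    (hp : p ∉ tsupport u) : normSq ε g u p = 0 := by
  simp [normSq, tensorInner, image_eq_zero_of_notMem_tsupport hp]

theorem gradNormSq_eq_zero (ε : Fin m → Variance) {u : Euc n → Tensor n m} {p : Euc n}
    (hp : p ∉ tsupport u) : gradNormSq ε g u p = 0 := by
  have h : ∀ k, covDeriv ε g u p k = 0 := fun k => by
    ext I
    have h1 : pderiv k (fun q => u q I) p = 0 :=
      pderiv_eq_zero_of_notMem (isClosed_tsupport u) (fun q hq => by
        rw [image_eq_zero_of_notMem_tsupport hq]; rfl) k hp
    simp [covDeriv_eq, h1, image_eq_zero_of_notMem_tsupport hp]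
  simp [gradNormSq, tensorInner, h]

/-- The divergence of `|u|² √(det g) φ` is bounded below in terms of that of `φ √(det g)` and of
the covariant derivative of `u`. -/
theorem sum_pderiv_normSq_mul_ge {p : Euc n}
    (hgd : ∀ i j, DifferentiableAt ℝ (fun q => g q i j) p) (hpos : ∀ᶠ q in 𝓝 p, (g q).PosDef)
    (ε : Fin m → Variance) {u : Euc n → Tensor n m} (hu : DifferentiableAt ℝ u p)
    {φ : Fin n → Euc n → ℝ} (hφ : ∀ k, DifferentiableAt ℝ (φ k) p) {κ l b : ℝ} (hκ : 0 < κ)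
    (hl : 0 < l) (hel : ∀ v : Fin n → ℝ, l * ∑ k, v k ^ 2 ≤ ∑ k, ∑ l, (g p)⁻¹ k l * (v k * v l))
    (hb : ∀ k, |φ k p| ≤ b) :
    normSq ε g u p * ∑ k, (pderiv k (φ k) p * volDensity g p + φ k p * pderiv k (volDensity g) p)
        - (n * κ * normSq ε g u p + b ^ 2 / κ / l * gradNormSq ε g u p) * volDensity g p
      ≤ ∑ k, pderiv k (fun q => normSq ε g u q * volDensity g q * φ k q) p := by
  have hG := hpos.self_of_nhds
  have hD : 0 < volDensity g p := Real.sqrt_pos.2 hG.det_pos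
  have hf := differentiableAt_normSq hgd hG.det_pos.ne' ε hu
  have hDd := differentiableAt_volDensity hgd hG.det_pos
  have huI : ∀ I, DifferentiableAt ℝ (fun q => u q I) p := fun I => differentiableAt_pi.1 hu I
  have h1 : ∀ k, pderiv k (fun q => normSq ε g u q * volDensity g q * φ k q) p
      = normSq ε g u p * (pderiv k (φ k) p * volDensity g p + φ k p * pderiv k (volDensity g) p)
        + 2 * (φ k p * tensorInner ε (g p) (covDeriv ε g u p k) (u p)) * volDensity g p := fun k => by
    rw [pderiv_mul k (hf.fun_mul hDd) (hφ k), pderiv_mul k hf hDd, pderiv_normSq hgd hpos ε huI]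
    ring
  simp only [h1]
  rw [Finset.sum_add_distrib (f := fun k => normSq ε g u p * _), ← Finset.mul_sum (a := normSq ε g u p),
    ← Finset.sum_mul (a := volDensity g p), sub_eq_add_neg, ← neg_mul]
  gcongr
  have h2 : ∀ k ∈ Finset.univ, -(κ * normSq ε g u p + b ^ 2 / κ
      * tensorInner ε (g p) (covDeriv ε g u p k) (covDeriv ε g u p k))
      ≤ 2 * (φ k p * tensorInner ε (g p) (covDeriv ε g u p k) (u p)) := fun k _ => by
    have h3 := two_mul_abs_tensorInner_le hG ε (covDeriv ε g u p k) (u p) hκ (φ k p)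
    have h4 : φ k p ^ 2 / κ ≤ b ^ 2 / κ := by
      have := sq_le_sq' (by linarith [neg_le_of_abs_le (hb k)]) (le_of_abs_le (hb k))
      gcongr
    have h5 := mul_le_mul_of_nonneg_right h4
      (tensorInner_self_nonneg hG ε (covDeriv ε g u p k))
    have h6 := neg_abs_le (φ k p * tensorInner ε (g p) (covDeriv ε g u p k) (u p))
    simp only [normSq]
    linarith
  refine le_trans ?_ (Finset.sum_le_sum h2)
  rw [Finset.sum_neg_distrib, Finset.sum_add_distrib, ← Finset.mul_sum (a := b ^ 2 / κ)]
  simp only [Finset.sum_const, Finset.card_univ, Fintype.card_fin, nsmul_eq_mul]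
  -- Cauchy–Schwarz was applied to each coordinate direction separately; ellipticity of the inverse
  -- metric compares the resulting Euclidean sum with `|∇u|²`.
  have h7 : l * ∑ k, tensorInner ε (g p) (covDeriv ε g u p k) (covDeriv ε g u p k)
      ≤ gradNormSq ε g u p := sum_tensorInner_self_le hG ε hel fun k => covDeriv ε g u p k
  have h8 : b ^ 2 / κ * ∑ k, tensorInner ε (g p) (covDeriv ε g u p k) (covDeriv ε g u p k)
      ≤ b ^ 2 / κ / l * gradNormSq ε g u p := by
    rw [div_mul_eq_mul_div _ l, le_div_iff₀ hl, mul_assoc]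
    exact mul_le_mul_of_nonneg_left (by linarith) (by positivity)
  linarith

/-! ### The integrated estimate -/

theorem measurableSet_sublevel (hΩ : IsOpen Ω) (hx : ContinuousOn x Ω) (hr : ContinuousOn r Ω)
    (x₀ R : ℝ) : MeasurableSet {p ∈ Ω | x₀ ≤ x p ∧ r p ≤ R} := by
  have h1 := (hx.isOpen_inter_preimage hΩ (isOpen_Iio (a := x₀))).measurableSet
  have h2 := (hr.isOpen_inter_preimage hΩ (isOpen_Ioi (a := R))).measurableSet
  have : {p ∈ Ω | x₀ ≤ x p ∧ r p ≤ R} = (Ω \ (Ω ∩ x ⁻¹' Iio x₀)) \ (Ω ∩ r ⁻¹' Ioi R) := by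
    ext p
    simp only [mem_ofPred_eq, Set.mem_sdiff, mem_inter_iff, mem_preimage, mem_Iio, mem_Ioi, not_and,
      not_lt]
    tauto
  rw [this]
  exact (hΩ.measurableSet.diff h1).diff h2

/-- The estimate for a single tensor field, given a vector field as in `exists_carlemanField`. -/
theorem volIntegral_weight_le (hΩ : IsOpen Ω) (hxc : ContinuousOn x Ω) (hrc : ContinuousOn r Ω)
    (hx0 : ∀ p ∈ Ω, 0 < x p) (hr0 : ∀ p ∈ Ω, 0 < r p)
    (hg : IsAsymptoticallyEuclideanMetric Ω g) {s σ μ x₀ c C R l : ℝ} (hc : 0 < c) (hC : 0 < C)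
    (hl : 0 < l) (hel : ∀ p ∈ Ω, ∀ v : Fin n → ℝ,
      l * ∑ k, v k ^ 2 ≤ ∑ k, ∑ l, (g p)⁻¹ k l * (v k * v l))
    {φ : Fin n → Euc n → ℝ} (hφ : ∀ k, ∀ p ∈ Ω, ContDiffAt ℝ 1 (φ k) p)
    (hφb : ∀ k, ∀ p ∈ Ω,
      |φ k p| ≤ C * (weight (2 * σ) (2 * μ) s (x p) (r p) * (x p ^ 2 / r p)))
    (hgood : ∀ᵐ p : Euc n, p ∈ Ω → (x p < x₀ ∨ R < r p) →
      c * (weight (2 * σ) (2 * μ) s (x p) (r p) * volDensity g p)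
      ≤ ∑ k, (pderiv k (φ k) p * volDensity g p + φ k p * pderiv k (volDensity g) p))
    (hbad : ∀ᵐ p : Euc n, p ∈ Ω → x₀ ≤ x p → r p ≤ R →
      c * (weight (2 * σ) (2 * μ) s (x p) (r p) * volDensity g p)
      ≤ ∑ k, (pderiv k (φ k) p * volDensity g p + φ k p * pderiv k (volDensity g) p)
        + C * volDensity g p)
    (ε : Fin m → Variance) {u : Euc n → Tensor n m} (hu : ContDiff ℝ 2 u)
    (huc : HasCompactSupport u) (huΩ : tsupport u ⊆ Ω) :
    c / 2 * volIntegral g Ω (fun p => weight (2 * σ) (2 * μ) s (x p) (r p) * normSq ε g u p)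
      ≤ C * volIntegral g {p ∈ Ω | x₀ ≤ x p ∧ r p ≤ R} (normSq ε g u)
        + C ^ 2 * (2 * (n + 1)) / c / l * volIntegral g Ω
          (fun p => weight (2 * σ + 4) (2 * μ + -2) s (x p) (r p) * gradNormSq ε g u p) := by
  classical
  set K := tsupport u with hKdef
  have hK : IsCompact K := huc
  set B : Set (Euc n) := {p ∈ Ω | x₀ ≤ x p ∧ r p ≤ R} with hB
  have hBm : MeasurableSet B := measurableSet_sublevel hΩ hxc hrc x₀ R
  have hBΩ : B ⊆ Ω := fun p hp => hp.1
  have hN0 : ∀ p ∉ K, normSq ε g u p = 0 := fun p hp => normSq_eq_zero ε hp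
  have hNlip := hg.locallyLipschitzOn_normSq_mul ε hu
  have hF0 : ∀ p ∉ K, normSq ε g u p * volDensity g p = 0 := fun p hp => by
    rw [hN0 p hp, zero_mul]
  have hFb : BddMeasOn K fun p => normSq ε g u p * volDensity g p :=
    BddMeasOn.of_continuousOn hK (hNlip.continuousOn.mono huΩ)
  have hDb : BddMeasOn K (volDensity g) := BddMeasOn.of_continuousOn hK fun p hp =>
    (IsAsymptoticallyEuclideanMetric.contDiffAt_sqrt_det (N := 0)
      (hg.posDef p (subset_closure (huΩ hp))).det_pos).continuousAt.comp_continuousWithinAt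
        ((hg.continuousOn p (subset_closure (huΩ hp))).mono (huΩ.trans subset_closure))
  have hwb : ∀ a b, BddMeasOn K fun p => weight a b s (x p) (r p) := fun a b => by
    refine BddMeasOn.of_continuousOn hK (ContinuousOn.mul (ContinuousOn.mul ?_ ?_) ?_)
    · exact (hxc.mono huΩ).rpow_const fun p hp => Or.inl (hx0 p (huΩ hp)).ne'
    · exact (hrc.mono huΩ).rpow_const fun p hp => Or.inl (hr0 p (huΩ hp)).ne'
    · exact ((continuousOn_const.mul (hrc.mono huΩ)).div (hxc.mono huΩ)
        fun p hp => (hx0 p (huΩ hp)).ne').rexp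
  -- integrability of all terms
  have i0 : Integrable fun p => normSq ε g u p * volDensity g p := hFb.integrable hK hF0
  have i1 : Integrable fun p =>
      weight (2 * σ) (2 * μ) s (x p) (r p) * normSq ε g u p * volDensity g p := by
    have := ((hwb (2 * σ) (2 * μ)).mul hFb).integrable hK fun p hp => by rw [hF0 p hp, mul_zero]
    simpa only [mul_assoc] using this
  have i3 : Integrable fun p =>
      weight (2 * σ + 4) (2 * μ + -2) s (x p) (r p) * gradNormSq ε g u p * volDensity g p :=
    (((hwb (2 * σ + 4) (2 * μ + -2)).mul (hg.bddMeasOn_gradNormSq hΩ hK huΩ ε hu)).mul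
      hDb).integrable hK fun p hp => by rw [gradNormSq_eq_zero ε hp, mul_zero, zero_mul]
  have hdiv : ∀ k, Integrable (pderiv k fun p => normSq ε g u p * volDensity g p * φ k p) ∧
      ∫ p, pderiv k (fun p => normSq ε g u p * volDensity g p * φ k p) p = 0 := fun k =>
    integral_pderiv_eq_zero hΩ hK huΩ
      (hNlip.real_mul (locallyLipschitzOn_of_contDiffAt fun p hp => hφ k p hp))
      (fun p hp => by rw [hF0 p hp, zero_mul]) k
  have i4 : Integrable fun p =>
      ∑ k, pderiv k (fun p => normSq ε g u p * volDensity g p * φ k p) p :=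
    integrable_finsetSum _ fun k _ => (hdiv k).1
  have i4z : ∫ p in Ω, ∑ k, pderiv k (fun p => normSq ε g u p * volDensity g p * φ k p) p = 0 := by
    rw [setIntegral_eq_integral_of_forall_compl_eq_zero, integral_finsetSum _ fun k _ => (hdiv k).1]
    · exact Finset.sum_eq_zero fun k _ => (hdiv k).2
    · intro p hp
      exact Finset.sum_eq_zero fun k _ => pderiv_eq_zero_of_notMem hK.isClosed
        (fun q hq => by rw [hF0 q hq, zero_mul]) k fun h => hp (huΩ h)
  have i2 : volIntegral g B (normSq ε g u)
      = ∫ p in Ω, B.indicator (fun p => normSq ε g u p * volDensity g p) p := by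
    rw [volIntegral, integral_indicator hBm, Measure.restrict_restrict hBm,
      inter_eq_self_of_subset_left hBΩ]
  -- the pointwise inequality
  have key : ∀ᵐ p ∂(volume.restrict Ω),
      c / 2 * (weight (2 * σ) (2 * μ) s (x p) (r p) * normSq ε g u p * volDensity g p)
      ≤ (C * B.indicator (fun p => normSq ε g u p * volDensity g p) p
        + C ^ 2 * (2 * (n + 1)) / c / l * (weight (2 * σ + 4) (2 * μ + -2) s (x p) (r p)
          * gradNormSq ε g u p * volDensity g p))
        + ∑ k, pderiv k (fun p => normSq ε g u p * volDensity g p * φ k p) p := by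
    rw [ae_restrict_iff' hΩ.measurableSet]
    filter_upwards [hgood, hbad, hg.ae_differentiableAt hΩ] with p h1 h2 h3 hp
    have hxp := hx0 p hp
    have hrp := hr0 p hp
    have hD := hg.volDensity_pos hp
    have hpd := hg.posDef p (subset_closure hp)
    have hN := normSq_nonneg hpd ε u
    have hw := weight_pos (2 * σ) (2 * μ) s hxp hrp
    set w := weight (2 * σ) (2 * μ) s (x p) (r p) with hwdef
    have hw4 : weight (2 * σ + 4) (2 * μ + -2) s (x p) (r p) = w * (x p ^ 4 / r p ^ 2) := by
      rw [weight_add _ _ _ _ _ hxp hrp, Real.rpow_neg hrp.le, Real.rpow_two,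
        show (4 : ℝ) = (4 : ℕ) by norm_num, Real.rpow_natCast]
      ring
    -- The Cauchy–Schwarz parameter is proportional to `w`: the `n` directions cost at most `c w /
    -- 2`, and the square of the field bound divided by it is a multiple of `w x⁴/r²`. The `n + 1`
    -- keeps it meaningful for `n = 0`.
    have hκ : 0 < c * w / (2 * (n + 1)) := by positivity
    have h4 := sum_pderiv_normSq_mul_ge (h3 hp) (hg.eventually_posDef hΩ hp) ε
      (hu.differentiable (by simp) p) (fun k => (hφ k p hp).differentiableAt (by simp)) hκ hl
      (hel p hp) (fun k => hφb k p hp)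
    have h5 : n * (c * w / (2 * (n + 1))) * normSq ε g u p * volDensity g p
        ≤ c / 2 * (w * normSq ε g u p * volDensity g p) := by
      have : n * (c * w / (2 * (n + 1))) * normSq ε g u p * volDensity g p
          = (n / (n + 1)) * (c / 2 * (w * normSq ε g u p * volDensity g p)) := by
        field_simp
      rw [this]
      exact mul_le_of_le_one_left (by positivity) ((div_le_one (by positivity)).2 (by linarith))
    have h6 : (C * (w * (x p ^ 2 / r p))) ^ 2 / (c * w / (2 * (n + 1))) / l * gradNormSq ε g u p
          * volDensity g p
        = C ^ 2 * (2 * (n + 1)) / c / l * (w * (x p ^ 4 / r p ^ 2) * gradNormSq ε g u p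
          * volDensity g p) := by
      field_simp
    have h7 : c * (w * normSq ε g u p * volDensity g p)
        ≤ normSq ε g u p * ∑ k, (pderiv k (φ k) p * volDensity g p
            + φ k p * pderiv k (volDensity g) p)
          + C * B.indicator (fun p => normSq ε g u p * volDensity g p) p := by
      by_cases hpB : p ∈ B
      · rw [indicator_of_mem hpB]
        have := mul_le_mul_of_nonneg_left (h2 hp hpB.2.1 hpB.2.2) hN
        linarith
      · rw [indicator_of_notMem hpB]
        have hor : x p < x₀ ∨ R < r p := by
          by_contra! h
          exact hpB ⟨hp, h.1, h.2⟩
        have := mul_le_mul_of_nonneg_left (h1 hp hor) hN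
        linarith
    rw [hw4]
    linarith
  have j1 := i1.integrableOn (s := Ω)
  have j2 : IntegrableOn (B.indicator fun p => normSq ε g u p * volDensity g p) Ω :=
    (i0.indicator hBm).integrableOn
  have j3 := i3.integrableOn (s := Ω)
  have j4 := i4.integrableOn (s := Ω)
  have hint := integral_mono_ae (j1.const_mul (c / 2))
    (((j2.const_mul C).fun_add (j3.const_mul (C ^ 2 * (2 * (n + 1)) / c / l))).add j4) key
  simp only [Pi.add_apply] at hint
  rw [integral_add ((j2.const_mul C).fun_add (j3.const_mul (C ^ 2 * (2 * (n + 1)) / c / l))) j4,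
    integral_add (j2.const_mul C) (j3.const_mul (C ^ 2 * (2 * (n + 1)) / c / l)), i4z,
    integral_const_mul, integral_const_mul, integral_const_mul, add_zero, ← i2] at hint
  exact hint

/-- The integrand is nonnegative at every point, also outside `Ω`, where `u` vanishes; so nothing is
required of `A`. -/
theorem sphereIntegral_normSq_nonneg (hg : IsAsymptoticallyEuclideanMetric Ω g) (R : ℝ)
    (A : Set (Euc n)) (ε : Fin m → Variance) {u : Euc n → Tensor n m} (huΩ : tsupport u ⊆ Ω) :
    0 ≤ sphereIntegral g R A (normSq ε g u) := by
  refine integral_nonneg fun p => mul_nonneg ?_ (Real.sqrt_nonneg _)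
  by_cases hp : p ∈ tsupport u
  · exact normSq_nonneg (hg.posDef p (subset_closure (huΩ hp))) ε u
  · exact (normSq_eq_zero ε hp).ge

theorem gradNormSq_nonneg {p : Euc n} (hg : (g p).PosDef) {l : ℝ} (hl : 0 < l)
    (hel : ∀ v : Fin n → ℝ, l * ∑ k, v k ^ 2 ≤ ∑ k, ∑ l, (g p)⁻¹ k l * (v k * v l))
    (ε : Fin m → Variance) (u : Euc n → Tensor n m) : 0 ≤ gradNormSq ε g u p :=
  (mul_nonneg hl.le (Finset.sum_nonneg fun _ _ => tensorInner_self_nonneg hg ε _)).trans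
    (sum_tensorInner_self_le hg ε hel fun k => covDeriv ε g u p k)

end Euc

theorem mainTheorem5 (n : ℕ) (Ω : Set (Euc n)) (R₀ : ℝ) (x r : Euc n → ℝ)
    (g : Euc n → Matrix (Fin n) (Fin n) ℝ)
    (hΩ : Euc.IsScaleInvariantDomain Ω R₀)
    (hx : Euc.IsScalingDefiningFunction Ω R₀ x)
    (hr : Euc.IsRadiusFunction Ω R₀ r)
    (hg : Euc.IsAsymptoticallyEuclideanMetric Ω g)
    (s σ μ : ℝ) (hs : s ≠ 0) (hβ : σ + μ + (n : ℝ) / 2 ≠ 0) :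
    ∃ x₀ C R : ℝ, 0 < x₀ ∧ 0 < C ∧ R₀ < R ∧ (∀ p ∈ Ω, r p = R ↔ ‖p‖ = R) ∧
      ∀ (m : ℕ) (ε : Fin m → Euc.Variance) (u : Euc n → Euc.Tensor n m),
        ContDiff ℝ 2 u → HasCompactSupport u → tsupport u ⊆ Ω →
        Euc.volIntegral g Ω (fun p =>
            x p ^ (2 * σ) * r p ^ (2 * μ) * Real.exp (-s * r p / x p) * Euc.normSq ε g u p)
          ≤ C * (Euc.sphereIntegral g R {p ∈ Ω | x₀ ≤ x p ∧ r p = R} (Euc.normSq ε g u)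
            + Euc.volIntegral g {p ∈ Ω | x₀ ≤ x p ∧ r p ≤ R} (Euc.normSq ε g u)
            + Euc.volIntegral g Ω (fun p =>
                x p ^ (2 * σ + 4) * r p ^ (2 * μ - 2) * Real.exp (-s * r p / x p)
                  * Euc.gradNormSq ε g u p)) := by
  obtain ⟨x₀, c, C, R, hx₀, hc, hC, hR, hrR, φ, hφ, hφb, hgood, hbad⟩ :=
    Euc.exists_carlemanField hΩ hx hr hg hs hβ
  obtain ⟨l, hl, hel⟩ := hg.exists_ellipticity
  have hxc : ContinuousOn x Ω := hx.smooth.continuousOn.mono subset_closure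
  have hrc : ContinuousOn r Ω := hr.smooth.continuousOn.mono subset_closure
  set C₂ := C ^ 2 * (2 * ((n : ℝ) + 1)) / c / l with hC₂
  have hC₂0 : 0 < C₂ := by positivity
  -- The factor `2 / c` undoes the `c / 2` left after absorption, and `C + C₂` dominates the
  -- coefficients of both remaining integrals.
  refine ⟨x₀, 2 / c * (C + C₂), R, hx₀, by positivity, hR, hrR, fun m ε u hu huc huΩ => ?_⟩
  have h := Euc.volIntegral_weight_le hΩ.isOpen hxc hrc hx.pos (fun p hp => hr.pos hp) hg hc hC hl
    hel hφ hφb hgood hbad ε hu huc huΩ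
  simp only [Euc.weight, ← sub_eq_add_neg, ← hC₂] at h
  have h1 := Euc.sphereIntegral_normSq_nonneg hg R {p ∈ Ω | x₀ ≤ x p ∧ r p = R} ε huΩ
  have h2 : 0 ≤ Euc.volIntegral g {p ∈ Ω | x₀ ≤ x p ∧ r p ≤ R} (Euc.normSq ε g u) :=
    setIntegral_nonneg (Euc.measurableSet_sublevel hΩ.isOpen hxc hrc x₀ R) fun p hp =>
      mul_nonneg (Euc.normSq_nonneg (hg.posDef p (subset_closure hp.1)) ε u) (Real.sqrt_nonneg _)
  have h3 : 0 ≤ Euc.volIntegral g Ω (fun p =>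
      x p ^ (2 * σ + 4) * r p ^ (2 * μ - 2) * Real.exp (-s * r p / x p)
        * Euc.gradNormSq ε g u p) :=
    setIntegral_nonneg hΩ.isOpen.measurableSet fun p hp => by
      have := hx.pos p hp
      have := hr.pos hp
      have := Euc.gradNormSq_nonneg (hg.posDef p (subset_closure hp)) hl (hel p hp) ε u
      have : 0 ≤ Euc.volDensity g p := Real.sqrt_nonneg _
      positivity
  generalize Euc.volIntegral g Ω _ = I₁ at h ⊢
  generalize Euc.sphereIntegral g R _ _ = I₂ at h1 ⊢
  generalize Euc.volIntegral g {p ∈ Ω | x₀ ≤ x p ∧ r p ≤ R} _ = I₃ at h h2 ⊢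
  generalize Euc.volIntegral g Ω _ = I₄ at h h3 ⊢
  have h4 : I₁ = 2 / c * (c / 2 * I₁) := by field_simp
  rw [h4, mul_assoc]
  refine mul_le_mul_of_nonneg_left (h.trans ?_) (by positivity)
  have e1 := mul_nonneg hC.le h1
  have e2 := mul_nonneg hC₂0.le h1
  have e3 := mul_nonneg hC₂0.le h2
  have e4 := mul_nonneg hC.le h3
  linarith
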